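/- Let $k$ be a field and let $A$, $B$ be symmetric $k$-algebras (finite-dimensional $k$-algebras that are isomorphic to their $k$-duals as bimodules) with symmetrising forms $s\in A^\vee$, $t\in B^\vee$ (images of $1$ under bimodule isomorphisms $A\cong A^\vee$, $B\cong B^\vee$), where $(-)^\vee=\mathrm{Hom}_k(-,k)$. Let $M$ be an $A$-$B$-bimodule, with the same $k$-action on both sides, that is finitely generated projective as a left $A$-module and as a right $B$-module, and view $M^\vee$ as a $B$-$A$-bimodule via $(b\mu a)(m)=\mu(amb)$. Let $U$ be a finitely generated $A$-module and $V$ a finitely generated $B$-module. Write $\underline{\mathrm{Hom}}$ for homomorphisms modulo those that factor through a projective module. *Choice of $\Omega$.* Let $\pi:P\to U$ and $\rho:Q\to M^\vee\otimes_A U$ be surjective homomorphisms of $A$-modules and of $B$-modules, respectively, with $P$, $Q$ finitely generated projective, and put $\Omega(U)=\ker\pi$ and $\Omega(M^\vee\otimes_AU)=\ker\rho$. Let $h:M^\vee\otimes_AP\to Q$ be any $B$-homomorphism with $\rho\circ h=\mathrm{Id}\otimes\pi$; it induces a map $M^\vee\otimes_A\Omega(U)\to\Omega(M^\vee\otimes_AU)$.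 *Tate duality.* For $X$ a finitely generated $A$-module and $\beta\in\mathrm{Hom}_A(X,P)$ let $\hat\beta\in\mathrm{Hom}_A(P,X)^\vee$ be the unique linear form that sends $y\mapsto\alpha(y)x$ to $s(\alpha(\beta(x)))$ for all $\alpha\in\mathrm{Hom}_A(P,A)$, $x\in X$. The Tate duality map $\underline{\mathrm{Hom}}_A(X,\Omega(U))\to\underline{\mathrm{Hom}}_A(U,X)^\vee$ sends the class of $\beta:X\to\ker\pi\subseteq P$ to the form $[f]\mapsto\hat\beta(f\circ\pi)$; it is defined in the same way for $B$, $t$, $\rho$. *Adjunction.* The adjunction $\mathrm{Hom}_A(M\otimes_BV,X)\to\mathrm{Hom}_B(V,M^\vee\otimes_AX)$ sends $\varphi$ to $v\mapsto\sum_i(s\circ\alpha_i)\otimes\varphi(m_i\otimes v)$, where $\alpha_i\in\mathrm{Hom}_A(M,A)$, $m_i\in M$ satisfy $\sum_i\alpha_i(m)m_i=m$ for all $m\in M$. The adjunction $\mathrm{Hom}_B(M^\vee\otimes_AX,V)\to\mathrm{Hom}_A(X,M\otimes_BV)$ sends $\psi$ to $x\mapsto\sum_jn_j\otimes\psi((t\circ\beta_j)\otimes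 x)$, where $\beta_j:M\to B$ are homomorphisms of right $B$-modules and $n_j\in M$ satisfy $\sum_jn_j\beta_j(m)=m$ for all $m\in M$. Both induce maps on $\underline{\mathrm{Hom}}$. Then $M^\vee\otimes_AP$ is a finitely generated projective $B$-module, $\mathrm{Id}\otimes\pi$ is surjective and the canonical map $M^\vee\otimes_A\ker\pi\to\ker(\mathrm{Id}\otimes\pi)$ is an isomorphism (so that $Q=M^\vee\otimes_AP$, $\rho=\mathrm{Id}\otimes\pi$, $h=\mathrm{Id}$ is an admissible choice), and the following is a commutative diagram of $k$-linear isomorphisms: $$\begin{array}{ccc} \underline{\mathrm{Hom}}_A(M\otimes_BV,\Omega(U)) & \longrightarrow & \underline{\mathrm{Hom}}_B(V,M^\vee\otimes_A\Omega(U))\;\cong\;\underline{\mathrm{Hom}}_B(V,\Omega(M^\vee\otimes_AU))\\ \downarrow & & \downarrow\\ \underline{\mathrm{Hom}}_A(U,M\otimes_BV)^\vee & \longrightarrow & \underline{\mathrm{Hom}}_B(M^\vee\otimes_AU,V)^\vee \end{array}$$ Here the upper left horizontal map is the adjunction, the upper right identification is induced by $h$, the lower horizontal map is the dual of the adjunction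 $\underline{\mathrm{Hom}}_B(M^\vee\otimes_AU,V)\to\underline{\mathrm{Hom}}_A(U,M\otimes_BV)$, and the vertical maps are the Tate duality maps. -/

import Mathlib

open scoped TensorProduct
open MulOpposite (op unop)

set_option linter.unusedSectionVars false
set_option linter.style.haveILetI false

namespace TateDuality

/-! ### Duals of bimodules, symmetric algebras

An `A`-`B`-bimodule `M` over the field `k` is given by instances `Module A M`, `Module Bᵐᵒᵖ M`
(the right action, `m b = op b • m`), `SMulCommClass A Bᵐᵒᵖ M`, and `Module k M` with
`IsScalarTower k A M` and `IsScalarTower k Bᵐᵒᵖ M` (the two `k`-structures coincide). -/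

section DualBimodule

variable (k : Type*) [Field k]

/-- The `k`-dual `M^∨ = Hom_k(M, k)`. For an `A`-`B`-bimodule `M` it is the `B`-`A`-bimodule with
`(b μ a)(m) = μ(a m b)`. -/
def DualBimodule (M : Type*) [AddCommGroup M] [Module k M] : Type _ := Module.Dual k M

variable {M : Type*} [AddCommGroup M] [Module k M]

noncomputable instance : AddCommGroup (DualBimodule k M) :=
  inferInstanceAs (AddCommGroup (Module.Dual k M))

noncomputable instance (priority := 1100) : Module k (DualBimodule k M) :=
  inferInstanceAs (Module k (Module.Dual k M))

instance : FunLike (DualBimodule k M) M k :=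
  inferInstanceAs (FunLike (Module.Dual k M) M k)

instance : LinearMapClass (DualBimodule k M) k M k :=
  inferInstanceAs (LinearMapClass (Module.Dual k M) k M k)

variable {k}

@[ext] theorem DualBimodule.ext {μ ν : DualBimodule k M} (h : ∀ m, μ m = ν m) : μ = ν :=
  LinearMap.ext h

@[simp] theorem DualBimodule.add_apply (μ ν : DualBimodule k M) (m : M) :
    (μ + ν) m = μ m + ν m := rfl

@[simp] theorem DualBimodule.zero_apply (m : M) : (0 : DualBimodule k M) m = 0 := rfl

@[simp] theorem DualBimodule.smul_apply (c : k) (μ : DualBimodule k M) (m : M) :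
    (c • μ) m = c * μ m := rfl

theorem DualBimodule.sum_apply {ι : Type*} (I : Finset ι) (μ : ι → DualBimodule k M) (m : M) :
    (∑ i ∈ I, μ i) m = ∑ i ∈ I, μ i m :=
  LinearMap.sum_apply I μ m

section Left

variable {B : Type*} [Ring B] [Algebra k B] [Module Bᵐᵒᵖ M] [IsScalarTower k Bᵐᵒᵖ M]

/-- The left action of `B` on `M^∨`: `(b μ)(m) = μ(m b)`. -/
noncomputable instance : Module B (DualBimodule k M) where
  smul b μ := LinearMap.comp (μ : Module.Dual k M) (Algebra.lsmul k k M (op b) : M →ₗ[k] M)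
  one_smul μ := by ext m; change μ ((1 : Bᵐᵒᵖ) • m) = μ m; rw [one_smul]
  mul_smul b c μ := by
    ext m; change μ (op (b * c) • m) = μ (op c • op b • m); rw [MulOpposite.op_mul, mul_smul]
  smul_zero b := by ext m; rfl
  smul_add b μ ν := by ext m; rfl
  add_smul b c μ := by
    ext m; change μ (op (b + c) • m) = μ (op b • m) + μ (op c • m)
    rw [MulOpposite.op_add, add_smul, map_add]
  zero_smul μ := by ext m; change μ ((0 : Bᵐᵒᵖ) • m) = 0; rw [zero_smul, map_zero]

@[simp] theorem DualBimodule.left_smul_apply (b : B) (μ : DualBimodule k M) (m : M) :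
    (b • μ) m = μ (op b • m) := rfl

instance : IsScalarTower k B (DualBimodule k M) :=
  ⟨fun c b μ => by
    ext m
    change μ (op (c • b) • m) = c * μ (op b • m)
    rw [MulOpposite.op_smul, smul_assoc, map_smul, smul_eq_mul]⟩

end Left

section Right

variable {A : Type*} [Ring A] [Algebra k A] [Module A M] [IsScalarTower k A M]

/-- The right action of `A` on `M^∨`: `(μ a)(m) = μ(a m)`. -/
noncomputable instance : Module Aᵐᵒᵖ (DualBimodule k M) where
  smul a μ := LinearMap.comp (μ : Module.Dual k M) (Algebra.lsmul k k M (unop a) : M →ₗ[k] M)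
  one_smul μ := by ext m; change μ ((1 : A) • m) = μ m; rw [one_smul]
  mul_smul b c μ := by
    ext m; change μ (unop (b * c) • m) = μ (unop c • unop b • m)
    rw [MulOpposite.unop_mul, mul_smul]
  smul_zero b := by ext m; rfl
  smul_add b μ ν := by ext m; rfl
  add_smul b c μ := by
    ext m; change μ (unop (b + c) • m) = μ (unop b • m) + μ (unop c • m)
    rw [MulOpposite.unop_add, add_smul, map_add]
  zero_smul μ := by ext m; change μ ((0 : A) • m) = 0; rw [zero_smul, map_zero]

@[simp] theorem DualBimodule.right_smul_apply (a : Aᵐᵒᵖ) (μ : DualBimodule k M) (m : M) :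
    (a • μ) m = μ (unop a • m) := rfl

instance : IsScalarTower k Aᵐᵒᵖ (DualBimodule k M) :=
  ⟨fun c a μ => by
    ext m
    change μ (unop (c • a) • m) = c * μ (unop a • m)
    rw [MulOpposite.unop_smul, smul_assoc, map_smul, smul_eq_mul]⟩

end Right

instance {A B : Type*} [Ring A] [Algebra k A] [Ring B] [Algebra k B] [Module A M]
    [Module Bᵐᵒᵖ M] [IsScalarTower k A M] [IsScalarTower k Bᵐᵒᵖ M] [SMulCommClass A Bᵐᵒᵖ M] :
    SMulCommClass B Aᵐᵒᵖ (DualBimodule k M) :=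
  ⟨fun b a μ => by
    ext m
    change μ (unop a • op b • m) = μ (op b • unop a • m)
    rw [smul_comm]⟩

/-- `s` is a symmetrising form of the `k`-algebra `A`: the image of `1` under some isomorphism
`A ≅ A^∨` of `A`-`A`-bimodules. An algebra is symmetric if it is finite-dimensional and has a
symmetrising form. -/
def IsSymmetrisingForm {A : Type*} [Ring A] [Algebra k A] (s : Module.Dual k A) : Prop :=
  ∃ Φ : A ≃ₗ[k] DualBimodule k A,
    (∀ a x : A, Φ (a • x) = a • Φ x) ∧ (∀ a x : A, Φ (op a • x) = op a • Φ x) ∧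
      ∀ x : A, Φ 1 x = s x

namespace IsSymmetrisingForm

variable {A : Type*} [Ring A] [Algebra k A] {s : Module.Dual k A}

theorem mul_comm (hs : IsSymmetrisingForm s) (x y : A) : s (x * y) = s (y * x) := by
  obtain ⟨Φ, hl, hr, h1⟩ := hs
  have e1 := hl y 1
  have e2 := hr y 1
  have e3 := congrArg (fun f : DualBimodule k A => f x) (e1.symm.trans (by simpa using e2))
  simpa [h1] using e3

theorem exists_rep (hs : IsSymmetrisingForm s) (f : Module.Dual k A) :
    ∃ a : A, ∀ x, s (a * x) = f x := by
  obtain ⟨Φ, hl, hr, h1⟩ := hs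
  obtain ⟨a, ha⟩ := Φ.surjective f
  refine ⟨a, fun x => ?_⟩
  have e2 := hr a 1
  have e3 := congrArg (fun f : DualBimodule k A => f x) e2
  have e4 : Φ a x = f x := congrArg (fun f : DualBimodule k A => f x) ha
  rw [← e4]
  simpa [h1] using e3.symm

theorem ext_left (hs : IsSymmetrisingForm s) {a b : A} (h : ∀ x, s (a * x) = s (b * x)) :
    a = b := by
  obtain ⟨Φ, hl, hr, h1⟩ := hs
  apply Φ.injective
  ext x
  have ea := congrArg (fun f : DualBimodule k A => f x) (hr a 1)
  have eb := congrArg (fun f : DualBimodule k A => f x) (hr b 1)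
  simp [h1] at ea eb
  rw [ea, eb, h x]

end IsSymmetrisingForm

end DualBimodule

/-! ### Tensor products over noncommutative algebras -/

section TensorOver

variable (k : Type*) [Field k] (B : Type*) [Ring B] [Algebra k B]
variable (M : Type*) [AddCommGroup M] [Module k M] [Module Bᵐᵒᵖ M] [IsScalarTower k Bᵐᵒᵖ M]
variable (V : Type*) [AddCommGroup V] [Module k V] [Module B V] [IsScalarTower k B V]

/-- The subspace of `M ⊗_k V` spanned by the elements `m b ⊗ v - m ⊗ b v`. -/
def balancedRelations : Submodule k (M ⊗[k] V) :=
  Submodule.span k {x | ∃ (m : M) (b : B) (v : V), x = (op b • m) ⊗ₜ[k] v - m ⊗ₜ[k] (b • v)}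

/-- The tensor product `M ⊗_B V` of a right `B`-module `M` and a left `B`-module `V` over the
`k`-algebra `B`. -/
def TensorOver : Type _ := (M ⊗[k] V) ⧸ balancedRelations k B M V

noncomputable instance : AddCommGroup (TensorOver k B M V) :=
  inferInstanceAs (AddCommGroup ((M ⊗[k] V) ⧸ balancedRelations k B M V))

namespace TensorOver

/-- The projection from `M ⊗_k V` onto `M ⊗_B V`. -/
noncomputable def proj : (M ⊗[k] V) →+ TensorOver k B M V :=
  (balancedRelations k B M V).mkQ.toAddMonoidHom

theorem proj_surjective : Function.Surjective (proj k B M V) :=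
  Submodule.mkQ_surjective _

variable {M V}

/-- The elementary tensor `m ⊗ v` in `M ⊗_B V`. -/
noncomputable def tmul (m : M) (v : V) : TensorOver k B M V := proj k B M V (m ⊗ₜ v)

theorem smul_tmul (b : B) (m : M) (v : V) : tmul k B (op b • m) v = tmul k B m (b • v) :=
  (Submodule.Quotient.eq _).2 (Submodule.subset_span ⟨m, b, v, rfl⟩)

theorem tmul_add (m : M) (v w : V) : tmul k B m (v + w) = tmul k B m v + tmul k B m w := by
  simp only [tmul, TensorProduct.tmul_add, map_add]

theorem add_tmul (m n : M) (v : V) : tmul k B (m + n) v = tmul k B m v + tmul k B n v := by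
  simp only [tmul, TensorProduct.add_tmul, map_add]

theorem tmul_zero (m : M) : tmul k B m (0 : V) = 0 := by
  simp only [tmul, TensorProduct.tmul_zero, map_zero]

theorem zero_tmul (v : V) : tmul k B (0 : M) v = 0 := by
  simp only [tmul, TensorProduct.zero_tmul, map_zero]

theorem tmul_sum {ι : Type*} (I : Finset ι) (m : M) (v : ι → V) :
    tmul k B m (∑ i ∈ I, v i) = ∑ i ∈ I, tmul k B m (v i) := by
  simp only [tmul, TensorProduct.tmul_sum, map_sum]

theorem sum_tmul {ι : Type*} (I : Finset ι) (m : ι → M) (v : V) :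
    tmul k B (∑ i ∈ I, m i) v = ∑ i ∈ I, tmul k B (m i) v := by
  simp only [tmul, TensorProduct.sum_tmul, map_sum]

theorem smul_tmul_base (c : k) (m : M) (v : V) : tmul k B (c • m) v = tmul k B m (c • v) := by
  simp only [tmul, TensorProduct.smul_tmul]

variable {k B}

theorem induction_on {p : TensorOver k B M V → Prop} (x : TensorOver k B M V) (zero : p 0)
    (tmul : ∀ m v, p (tmul k B m v)) (add : ∀ x y, p x → p y → p (x + y)) : p x := by
  obtain ⟨y, rfl⟩ := proj_surjective k B M V x
  induction y with
  | zero => simpa using zero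
  | tmul m v => exact tmul m v
  | add y z hy hz => rw [map_add]; exact add _ _ hy hz

/-- A balanced biadditive map induces a map on `M ⊗_B V`. -/
noncomputable def lift {N : Type*} [AddCommGroup N] (f : M →+ V →+ N)
    (hk : ∀ (c : k) m v, f (c • m) v = f m (c • v))
    (hB : ∀ (b : B) m v, f (op b • m) v = f m (b • v)) : TensorOver k B M V →+ N :=
  QuotientAddGroup.lift (balancedRelations k B M V).toAddSubgroup
    (TensorProduct.liftAddHom f hk) (by
      intro x hx
      rw [AddMonoidHom.mem_ker]
      change x ∈ balancedRelations k B M V at hx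
      rw [balancedRelations] at hx
      induction hx using Submodule.span_induction with
      | mem x h =>
        obtain ⟨m, b, v, rfl⟩ := h
        simp [hB]
      | zero => simp
      | add x y _ _ hx hy => simp [hx, hy]
      | smul c x hx' hx =>
        clear hx
        induction hx' using Submodule.span_induction generalizing c with
        | mem x h =>
          obtain ⟨m, b, v, rfl⟩ := h
          have : op b • c • m = c • op b • m := by rw [smul_comm]
          simp only [smul_sub, TensorProduct.smul_tmul', map_sub, TensorProduct.liftAddHom_tmul]
          rw [← this, hB, sub_self]
        | zero => simp
        | add x y _ _ hx hy => simp [smul_add, hx, hy]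
        | smul d x _ hx => rw [smul_smul]; exact hx _)

@[simp] theorem lift_tmul {N : Type*} [AddCommGroup N] (f : M →+ V →+ N)
    (hk : ∀ (c : k) m v, f (c • m) v = f m (c • v))
    (hB : ∀ (b : B) m v, f (op b • m) v = f m (b • v)) (m : M) (v : V) :
    lift f hk hB (tmul k B m v) = f m v := rfl

section Action

variable {R : Type*} [Semiring R] [Module R M] [SMulCommClass R k M] [SMulCommClass R Bᵐᵒᵖ M]

/-- Multiplication by `r` on the left factor. -/
noncomputable def smulHom (r : R) : TensorOver k B M V →+ TensorOver k B M V :=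
  lift
    { toFun := fun m =>
        { toFun := fun v => tmul k B (r • m) v
          map_zero' := tmul_zero _ _ _
          map_add' := fun v w => tmul_add _ _ _ v w }
      map_zero' := by ext v; simp [zero_tmul]
      map_add' := fun m n => by ext v; simp [add_tmul] }
    (fun c m v => by
      change tmul k B (r • c • m) v = tmul k B (r • m) (c • v)
      rw [← smul_tmul_base, smul_comm])
    (fun b m v => by
      change tmul k B (r • op b • m) v = tmul k B (r • m) (b • v)
      rw [← smul_tmul, smul_comm])

/-- If `R` acts on `M`, commuting with `k` and `B`, then it acts on `M ⊗_B V` by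
`r (m ⊗ v) = r m ⊗ v`. This covers the action of `k`, and that of `A` if `M` is an
`A`-`B`-bimodule. -/
noncomputable instance instModule : Module R (TensorOver k B M V) where
  smul r x := smulHom r x
  one_smul x := by
    change smulHom (1 : R) x = x
    induction x using induction_on with
    | zero => exact map_zero _
    | tmul m v => change tmul k B ((1 : R) • m) v = _; rw [one_smul]
    | add x y hx hy => rw [map_add, hx, hy]
  mul_smul r t x := by
    change smulHom (r * t) x = smulHom r (smulHom t x)
    induction x using induction_on with
    | zero => simp
    | tmul m v => change tmul k B ((r * t) • m) v = tmul k B (r • t • m) v; rw [mul_smul]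
    | add x y hx hy => simp only [map_add, hx, hy]
  smul_zero r := map_zero (smulHom r)
  smul_add r x y := map_add (smulHom r) x y
  add_smul r t x := by
    change smulHom (r + t) x = smulHom r x + smulHom t x
    induction x using induction_on with
    | zero => simp
    | tmul m v =>
      change tmul k B ((r + t) • m) v = tmul k B (r • m) v + tmul k B (t • m) v
      rw [add_smul, add_tmul]
    | add x y hx hy => simp only [map_add, hx, hy]; abel
  zero_smul x := by
    change smulHom (0 : R) x = 0
    induction x using induction_on with
    | zero => simp
    | tmul m v => change tmul k B ((0 : R) • m) v = 0; rw [zero_smul, zero_tmul]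
    | add x y hx hy => simp only [map_add, hx, hy, add_zero]

theorem smul_tmul' (r : R) (m : M) (v : V) : r • tmul k B m v = tmul k B (r • m) v := rfl

end Action

section Bimodule

variable {A : Type*} [Ring A] [Algebra k A] [Module A M] [IsScalarTower k A M]
  [SMulCommClass A Bᵐᵒᵖ M]

instance : IsScalarTower k A (TensorOver k B M V) :=
  ⟨fun c a x => by
    induction x using induction_on with
    | zero => simp
    | tmul m v => rw [smul_tmul', smul_tmul', smul_tmul', smul_assoc]
    | add x y hx hy => simp only [smul_add, hx, hy]⟩

instance finite_base [Module.Finite k M] [Module.Finite k V] :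
    Module.Finite k (TensorOver k B M V) :=
  Module.Finite.of_surjective
    ({ toFun := proj k B M V
       map_add' := map_add _
       map_smul' := fun c x => by
        induction x with
        | zero => simp
        | tmul m v => rw [TensorProduct.smul_tmul']; rfl
        | add x y hx hy => simp only [smul_add, map_add, hx, hy] } :
      (M ⊗[k] V) →ₗ[k] TensorOver k B M V)
    (proj_surjective k B M V)

/-- Over finite-dimensional algebras, `M ⊗_B V` is finitely generated if `M` and `V` are. -/
instance finite [Module.Finite k A] [Module.Finite k B] [Module.Finite A M] [Module.Finite B V] :
    Module.Finite A (TensorOver k B M V) := by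
  haveI : Module.Finite k M := Module.Finite.trans A M
  haveI : Module.Finite k V := Module.Finite.trans B V
  exact Module.Finite.of_restrictScalars_finite k A _

variable {V' : Type*} [AddCommGroup V'] [Module k V'] [Module B V'] [IsScalarTower k B V']

variable (M A) in
/-- The functor `M ⊗_B -` on morphisms: `Id ⊗ g`. -/
noncomputable def map (g : V →ₗ[B] V') : TensorOver k B M V →ₗ[A] TensorOver k B M V' where
  toFun := lift
    { toFun := fun m =>
        { toFun := fun v => tmul k B m (g v)
          map_zero' := by rw [map_zero, tmul_zero]
          map_add' := fun v w => by rw [map_add, tmul_add] }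
      map_zero' := by ext v; simp [zero_tmul]
      map_add' := fun m n => by ext v; simp [add_tmul] }
    (fun c m v => by
      change tmul k B (c • m) (g v) = tmul k B m (g (c • v))
      rw [smul_tmul_base, LinearMap.map_smul_of_tower])
    (fun b m v => by
      change tmul k B (op b • m) (g v) = tmul k B m (g (b • v))
      rw [smul_tmul, map_smul])
  map_add' := map_add _
  map_smul' a x := by
    induction x using induction_on with
    | zero => simp
    | tmul m v => rfl
    | add x y hx hy => simp only [smul_add, map_add, hx, hy]

@[simp] theorem map_tmul (g : V →ₗ[B] V') (m : M) (v : V) :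
    map M A g (tmul k B m v) = tmul k B m (g v) := rfl

/-- `M ⊗_B P` is projective if `M` is projective as left module and `P` is projective. -/
instance projective [Module.Projective A M] [Module.Projective B V] :
    Module.Projective A (TensorOver k B M V) := by
  obtain ⟨σ, hσ⟩ := (Module.projective_def.mp (inferInstance : Module.Projective B V))
  haveI : Module.Projective A (V →₀ M) := by
    classical
    exact Module.Projective.of_equiv (finsuppLequivDFinsupp (ι := V) (M := M) A).symm
  let f : M →+ V →+ (V →₀ M) :=
    { toFun := fun m =>
        { toFun := fun v => (σ v).mapRange (fun b => op b • m) (by simp)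
          map_zero' := by ext q; simp
          map_add' := fun v w => by ext q; simp [add_smul] }
      map_zero' := by ext v q; simp
      map_add' := fun m n => by ext v q; simp }
  have hf : ∀ m v q, f m v q = op (σ v q) • m := fun m v q => rfl
  let i : TensorOver k B M V →ₗ[A] (V →₀ M) :=
    { toFun := lift f
        (fun c m v => by
          ext q
          rw [hf, hf, LinearMap.map_smul_of_tower, Finsupp.smul_apply, MulOpposite.op_smul,
            smul_assoc, smul_comm])
        (fun b m v => by
          ext q
          rw [hf, hf, map_smul, Finsupp.smul_apply, smul_eq_mul, MulOpposite.op_mul, mul_smul])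
      map_add' := map_add _
      map_smul' := fun a x => by
        induction x using induction_on with
        | zero => simp
        | tmul m v =>
          ext q
          rw [smul_tmul', lift_tmul, lift_tmul, RingHom.id_apply, Finsupp.smul_apply, hf, hf]
          exact (smul_comm a _ m).symm
        | add x y hx hy => simp only [smul_add, map_add, hx, hy] }
  have hi : ∀ m v, i (tmul k B m v) = f m v := fun m v => rfl
  let r : (V →₀ M) →ₗ[A] TensorOver k B M V :=
    Finsupp.lsum ℕ fun q =>
      { toFun := fun m => tmul k B m q
        map_add' := fun m n => add_tmul _ _ m n q
        map_smul' := fun a m => (smul_tmul' a m q).symm }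
  have hr : ∀ g : V →₀ M, r g = g.sum fun q m => tmul k B m q := fun g => rfl
  refine Module.Projective.of_split i r ?_
  ext x
  induction x using induction_on with
  | zero => simp
  | tmul m v =>
    have h1 : v = ∑ q ∈ (σ v).support, σ v q • q := (hσ v).symm
    rw [LinearMap.comp_apply, hi, hr, LinearMap.id_apply]
    change ((σ v).mapRange (fun b => op b • m) (by simp)).sum _ = _
    rw [Finsupp.sum_mapRange_index (h := fun q m => tmul k B m q) (fun q => zero_tmul _ _ _)]
    conv_rhs => rw [h1, tmul_sum]
    exact Finset.sum_congr rfl fun q _ => smul_tmul k B _ _ _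
  | add x y hx hy => simp only [map_add, hx, hy]

end Bimodule

end TensorOver

end TensorOver


/-! ### Homomorphisms in the stable module category -/

section StableHom

universe uk uR uX uY uZ w

variable (k : Type uk) [Field k] (R : Type uR) [Ring R] [Algebra k R]
variable (X : Type uX) [AddCommGroup X] [Module R X]
variable (Y : Type uY) [AddCommGroup Y] [Module k Y] [Module R Y] [IsScalarTower k R Y]
variable (Z : Type uZ) [AddCommGroup Z] [Module k Z] [Module R Z] [IsScalarTower k R Z]

/-- `Hom_R^pr(X, Y)`: the homomorphisms `X → Y` that factor through a projective `R`-module. -/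
def projHom : Submodule k (X →ₗ[R] Y) where
  carrier := {f | ∃ (P : Type (max uR uY)) (_ : AddCommGroup P) (_ : Module R P)
    (g : X →ₗ[R] P) (h : P →ₗ[R] Y), Module.Projective R P ∧ f = h ∘ₗ g}
  add_mem' := by
    rintro _ _ ⟨P, _, _, g, h, hP, rfl⟩ ⟨P', _, _, g', h', hP', rfl⟩
    exact ⟨P × P', inferInstance, inferInstance, g.prod g', h.coprod h', inferInstance, by
      ext x; simp⟩
  zero_mem' := ⟨PUnit, inferInstance, inferInstance, 0, 0, inferInstance, by ext; simp⟩
  smul_mem' := by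
    rintro c _ ⟨P, _, _, g, h, hP, rfl⟩
    exact ⟨P, inferInstance, inferInstance, g, c • h, hP, by ext; simp⟩

/-- The space of morphisms `Hom_R(X, Y) / Hom_R^pr(X, Y)` of the stable module category. -/
abbrev StableHom : Type _ := (X →ₗ[R] Y) ⧸ projHom k R X Y

variable {R X Y Z}

/-- The projective module in the definition of `projHom` may live in any universe. -/
theorem comp_mem_projHom {P : Type w} [AddCommGroup P] [Module R P] [Module.Projective R P]
    (g : X →ₗ[R] P) (h : P →ₗ[R] Y) : h ∘ₗ g ∈ projHom k R X Y := by
  obtain ⟨l, hl⟩ := Module.projective_lifting_property (Finsupp.linearCombination R (id : Y → Y)) h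
    (Finsupp.linearCombination_id_surjective R Y)
  exact ⟨Y →₀ R, inferInstance, inferInstance, l ∘ₗ g, Finsupp.linearCombination R (id : Y → Y),
    inferInstance, by rw [← LinearMap.comp_assoc, hl]⟩

variable {k}

theorem exists_eq_sum_smulRight [Module.Finite R Y] {f : X →ₗ[R] Y} (hf : f ∈ projHom k R X Y) :
    ∃ (n : ℕ) (κ : Fin n → (X →ₗ[R] R)) (y : Fin n → Y), f = ∑ i, (κ i).smulRight (y i) := by
  obtain ⟨P, _, _, g, h, hP, rfl⟩ := hf
  obtain ⟨n, p, hp⟩ := Module.Finite.exists_fin' R Y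
  obtain ⟨l, hl⟩ := Module.projective_lifting_property p h hp
  refine ⟨n, fun i => LinearMap.proj i ∘ₗ l ∘ₗ g, fun i => p (Pi.single i 1), ?_⟩
  ext x
  rw [← hl]
  simp only [LinearMap.comp_apply, LinearMap.sum_apply, LinearMap.smulRight_apply,
    LinearMap.proj_apply]
  conv_lhs => rw [pi_eq_sum_univ' (l (g x))]
  simp only [map_sum, map_smul]

variable (k X)

/-- Composition with `g : Y → Z` on morphism spaces of the stable category. -/
noncomputable def stablePostcomp (g : Y →ₗ[R] Z) : StableHom k R X Y →ₗ[k] StableHom k R X Z :=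
  Submodule.mapQ _ _
    ({ toFun := fun f => g ∘ₗ f
       map_add' := fun f f' => by ext x; simp
       map_smul' := fun c f => by ext x; simp [LinearMap.map_smul_of_tower] } :
      (X →ₗ[R] Y) →ₗ[k] (X →ₗ[R] Z))
    (by
      rintro _ ⟨P, _, _, f, h, hP, rfl⟩
      exact comp_mem_projHom k f (g ∘ₗ h))

end StableHom

/-! ### Tate duality for symmetric algebras -/

section Tate

/-- A finite dual basis of an `R`-module `P`. -/
structure DualBasis (R P : Type*) [Ring R] [AddCommGroup P] [Module R P] where
  n : ℕ
  coord : Fin n → (P →ₗ[R] R)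
  vec : Fin n → P
  sum_smul : ∀ x, ∑ i, coord i x • vec i = x

/-- A chosen dual basis of a finitely generated projective module. -/
noncomputable def dualBasis (R P : Type*) [Ring R] [AddCommGroup P] [Module R P]
    [Module.Finite R P] [Module.Projective R P] : DualBasis R P :=
  Classical.choice <| by
    obtain ⟨n, f, g, -, -, hfg⟩ := Module.Finite.exists_comp_eq_id_of_projective R P
    refine ⟨⟨n, fun i => LinearMap.proj i ∘ₗ g, fun i => f (Pi.single i 1), fun x => ?_⟩⟩
    conv_rhs => rw [← LinearMap.id_apply (R := R) x, ← hfg, LinearMap.comp_apply,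
      pi_eq_sum_univ' (g x)]
    simp only [map_sum, map_smul]
    exact Finset.sum_congr rfl fun i _ => rfl

variable {k : Type*} [Field k] {A : Type*} [Ring A] [Algebra k A]
variable (s : Module.Dual k A)
variable {P : Type*} [AddCommGroup P] [Module k P] [Module A P] [IsScalarTower k A P]
  [Module.Finite A P] [Module.Projective A P]
variable (V : Type*) [AddCommGroup V] [Module k V] [Module A V] [IsScalarTower k A V]

variable (P) in
/-- For `P` finitely generated projective, the map `Hom_A(V, P) → Hom_A(P, V)^∨`, `β ↦ β^`, where
`β^` sends `x ↦ α(x) v` to `s(α(β(v)))`, for `α ∈ Hom_A(P, A)` and `v ∈ V`. It is written in terms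
of a dual basis; `homDual_smulRight` and `homDual_unique` say that it is characterised by the
formula just given. -/
noncomputable def homDual : (V →ₗ[A] P) →ₗ[k] Module.Dual k (P →ₗ[A] V) :=
  LinearMap.mk₂ k
    (fun β f => ∑ i, s ((dualBasis A P).coord i (β (f ((dualBasis A P).vec i)))))
    (fun β β' f => by simp [Finset.sum_add_distrib])
    (fun c β f => by
      simp [LinearMap.map_smul_of_tower, Finset.mul_sum])
    (fun β f f' => by simp [Finset.sum_add_distrib])
    (fun c β f => by
      simp [LinearMap.map_smul_of_tower, Finset.mul_sum])

variable {s V}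

theorem homDual_apply (β : V →ₗ[A] P) (f : P →ₗ[A] V) :
    homDual s P V β f = ∑ i, s ((dualBasis A P).coord i (β (f ((dualBasis A P).vec i)))) := rfl

theorem homDual_smulRight (hs : IsSymmetrisingForm s) (β : V →ₗ[A] P) (α : P →ₗ[A] A) (v : V) :
    homDual s P V β (α.smulRight v) = s (α (β v)) := by
  rw [homDual_apply]
  conv_rhs => rw [← (dualBasis A P).sum_smul (β v)]
  simp only [map_sum, map_smul, LinearMap.smulRight_apply, smul_eq_mul]
  exact Finset.sum_congr rfl fun i _ => hs.mul_comm _ _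

theorem homDual_unique (hs : IsSymmetrisingForm s) (β : V →ₗ[A] P)
    (φ : Module.Dual k (P →ₗ[A] V))
    (hφ : ∀ (α : P →ₗ[A] A) (v : V), φ (α.smulRight v) = s (α (β v))) :
    φ = homDual s P V β := by
  ext f
  have hf : f = ∑ i, ((dualBasis A P).coord i).smulRight (f ((dualBasis A P).vec i)) := by
    ext x
    conv_lhs => rw [← (dualBasis A P).sum_smul x]
    simp
  rw [hf, map_sum, map_sum]
  exact Finset.sum_congr rfl fun i _ => by rw [hφ, homDual_smulRight hs]

variable {U : Type*} [AddCommGroup U] [Module k U] [Module A U] [IsScalarTower k A U]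

variable (s V) in
/-- The map `T : Hom_A(V, ker π) → Hom_A(U, V)^∨` given by `T(β)(f) = β^(f ∘ π)`, for a
homomorphism `π : P → U`. -/
noncomputable def tateMap (π : P →ₗ[A] U) :
    (V →ₗ[A] LinearMap.ker π) →ₗ[k] Module.Dual k (U →ₗ[A] V) :=
  LinearMap.mk₂ k (fun β f => homDual s P V ((LinearMap.ker π).subtype ∘ₗ β) (f ∘ₗ π))
    (fun β β' f => by rw [LinearMap.comp_add, map_add, LinearMap.add_apply])
    (fun c β f => by
      rw [← LinearMap.smul_apply, ← map_smul]
      congr 2)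
    (fun β f f' => by rw [LinearMap.add_comp, map_add])
    (fun c β f => by rw [LinearMap.smul_comp, map_smul])

theorem tateMap_apply (π : P →ₗ[A] U) (β : V →ₗ[A] LinearMap.ker π) (f : U →ₗ[A] V) :
    tateMap s V π β f = homDual s P V ((LinearMap.ker π).subtype ∘ₗ β) (f ∘ₗ π) := rfl

theorem tateMap_right (hs : IsSymmetrisingForm s) [Module.Finite A V] (π : P →ₗ[A] U)
    (β : V →ₗ[A] LinearMap.ker π) {f : U →ₗ[A] V} (hf : f ∈ projHom k A U V) :
    tateMap s V π β f = 0 := by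
  obtain ⟨n, κ, y, rfl⟩ := exists_eq_sum_smulRight hf
  rw [map_sum]
  refine Finset.sum_eq_zero fun i _ => ?_
  have h : (κ i).smulRight (y i) ∘ₗ π = (κ i ∘ₗ π).smulRight (y i) := by ext; simp
  rw [tateMap_apply, h, homDual_smulRight hs]
  simp [LinearMap.mem_ker.1 (β (y i)).2]

theorem tateMap_left (hs : IsSymmetrisingForm s) [Module.Finite k A] (π : P →ₗ[A] U)
    {β : V →ₗ[A] LinearMap.ker π} (hβ : β ∈ projHom k A V (LinearMap.ker π)) (f : U →ₗ[A] V) :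
    tateMap s V π β f = 0 := by
  haveI : IsNoetherianRing A := isNoetherian_of_tower k (inferInstance : IsNoetherian k A)
  obtain ⟨n, γ, y, rfl⟩ := exists_eq_sum_smulRight hβ
  rw [map_sum, LinearMap.sum_apply]
  refine Finset.sum_eq_zero fun i _ => ?_
  rw [tateMap_apply, homDual_apply]
  have h : ∀ j, s ((dualBasis A P).coord j (((LinearMap.ker π).subtype ∘ₗ (γ i).smulRight (y i))
      ((f ∘ₗ π) ((dualBasis A P).vec j)))) =
      s (γ i (f (π ((dualBasis A P).coord j (y i) • (dualBasis A P).vec j)))) := by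
    intro j
    simp only [LinearMap.comp_apply, LinearMap.smulRight_apply, map_smul, Submodule.subtype_apply,
      smul_eq_mul]
    exact hs.mul_comm _ _
  rw [Finset.sum_congr rfl fun j _ => h j, ← map_sum, ← map_sum, ← map_sum, ← map_sum,
    (dualBasis A P).sum_smul, LinearMap.mem_ker.1 (y i).2, map_zero, map_zero, map_zero]

variable (V) in
/-- The Tate duality map from the stable `Hom_A(V, Ω(U))` to the dual of the stable `Hom_A(U, V)`
for the symmetric algebra `A` with symmetrising form `s`, where `Ω(U) = ker π` for a
surjective homomorphism `π : P → U` with `P` finitely generated projective. It is induced by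
`tateMap`. -/
noncomputable def tateDuality (hs : IsSymmetrisingForm s) [Module.Finite k A] [Module.Finite A V]
    (π : P →ₗ[A] U) :
    StableHom k A V (LinearMap.ker π) →ₗ[k] Module.Dual k (StableHom k A U V) :=
  Submodule.liftQ _
    { toFun := fun β => Submodule.liftQ _ (tateMap s V π β) fun _ hf => tateMap_right hs π β hf
      map_add' := fun β β' => by
        ext f
        exact congrArg (fun φ : Module.Dual k (U →ₗ[A] V) => φ f) (map_add (tateMap s V π) β β')
      map_smul' := fun c β => by
        ext f
        exact congrArg (fun φ : Module.Dual k (U →ₗ[A] V) => φ f)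
          (map_smul (tateMap s V π) c β) }
    (fun β hβ => by
      rw [LinearMap.mem_ker]
      ext f
      exact tateMap_left hs π hβ f)

theorem tateDuality_mk (hs : IsSymmetrisingForm s) [Module.Finite k A] [Module.Finite A V]
    (π : P →ₗ[A] U) (β : V →ₗ[A] LinearMap.ker π) (f : U →ₗ[A] V) :
    tateDuality V hs π (Submodule.Quotient.mk β) (Submodule.Quotient.mk f) =
      homDual s P V ((LinearMap.ker π).subtype ∘ₗ β) (f ∘ₗ π) := rfl

end Tate

/-! ### The adjunctions between `M ⊗_B -` and `M^∨ ⊗_A -` -/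

section Adjunction

variable {k : Type*} [Field k] {A : Type*} [Ring A] [Algebra k A] {B : Type*} [Ring B]
  [Algebra k B]
variable {s : Module.Dual k A} {t : Module.Dual k B}
variable (M : Type*) [AddCommGroup M] [Module k M] [Module A M] [Module Bᵐᵒᵖ M]
  [IsScalarTower k A M] [IsScalarTower k Bᵐᵒᵖ M] [SMulCommClass A Bᵐᵒᵖ M]
variable (X : Type*) [AddCommGroup X] [Module k X] [Module A X] [IsScalarTower k A X]
variable (V : Type*) [AddCommGroup V] [Module k V] [Module B V] [IsScalarTower k B V]

variable {M} in
/-- `s ∘ α ∈ M^∨` for `α ∈ Hom_A(M, A)`. -/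
def formComp (s : Module.Dual k A) (α : M →ₗ[A] A) : DualBimodule k M :=
  s ∘ₗ α.restrictScalars k

variable {M} in
/-- `t ∘ β ∈ M^∨` for a homomorphism of right `B`-modules `β : M → B`, given as a homomorphism
`M → Bᵐᵒᵖ` of left `Bᵐᵒᵖ`-modules. -/
def formCompOp (t : Module.Dual k B) (β : M →ₗ[Bᵐᵒᵖ] Bᵐᵒᵖ) : DualBimodule k M :=
  t ∘ₗ (MulOpposite.opLinearEquiv k).symm.toLinearMap ∘ₗ β.restrictScalars k

variable {M}

@[simp] theorem formComp_apply (s : Module.Dual k A) (α : M →ₗ[A] A) (m : M) :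
    formComp s α m = s (α m) := rfl

@[simp] theorem formCompOp_apply (t : Module.Dual k B) (β : M →ₗ[Bᵐᵒᵖ] Bᵐᵒᵖ) (m : M) :
    formCompOp t β m = t (unop (β m)) := rfl

variable (M)

section Unit

variable [Module.Finite A M] [Module.Projective A M]

theorem sum_formComp_tmul_op_smul (hs : IsSymmetrisingForm s) (b : B) :
    ∑ i, TensorOver.tmul k A (formComp s ((dualBasis A M).coord i))
      (op b • (dualBasis A M).vec i) =
    ∑ i, TensorOver.tmul k A (b • formComp s ((dualBasis A M).coord i))
      ((dualBasis A M).vec i) := by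
  have h1 : ∀ i, TensorOver.tmul k A (formComp s ((dualBasis A M).coord i))
      (op b • (dualBasis A M).vec i) = ∑ j, TensorOver.tmul k A
        (op ((dualBasis A M).coord j (op b • (dualBasis A M).vec i)) •
          formComp s ((dualBasis A M).coord i)) ((dualBasis A M).vec j) := by
    intro i
    conv_lhs => rw [← (dualBasis A M).sum_smul (op b • (dualBasis A M).vec i)]
    rw [TensorOver.tmul_sum]
    exact Finset.sum_congr rfl fun j _ => (TensorOver.smul_tmul k A _ _ _).symm
  rw [Finset.sum_congr rfl fun i _ => h1 i, Finset.sum_comm]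
  refine Finset.sum_congr rfl fun j _ => ?_
  rw [← TensorOver.sum_tmul]
  congr 1
  ext m
  rw [DualBimodule.sum_apply]
  simp only [DualBimodule.right_smul_apply, DualBimodule.left_smul_apply, formComp_apply,
    MulOpposite.unop_op, map_smul, smul_eq_mul]
  conv_rhs => rw [← (dualBasis A M).sum_smul m, Finset.smul_sum]
  simp only [map_sum]
  refine Finset.sum_congr rfl fun i _ => ?_
  rw [← smul_comm ((dualBasis A M).coord i m) (op b),
    ((dualBasis A M).coord j).map_smul ((dualBasis A M).coord i m), smul_eq_mul, hs.mul_comm]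

/-- The adjunction isomorphism `Hom_A(M ⊗_B V, X) ≅ Hom_B(V, M^∨ ⊗_A X)`,
`φ ↦ (v ↦ ∑ (s ∘ α_i) ⊗ φ(m_i ⊗ v))`, given by the unit of the adjunction. -/
noncomputable def adjunctionHom (hs : IsSymmetrisingForm s) :
    (TensorOver k B M V →ₗ[A] X) →ₗ[k] (V →ₗ[B] TensorOver k A (DualBimodule k M) X) where
  toFun φ :=
    { toFun := fun v => ∑ i, TensorOver.tmul k A (formComp s ((dualBasis A M).coord i))
        (φ (TensorOver.tmul k B ((dualBasis A M).vec i) v))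
      map_add' := fun v w => by
        simp only [TensorOver.tmul_add, map_add, Finset.sum_add_distrib]
      map_smul' := fun b v => by
        let ψ : TensorOver k A (DualBimodule k M) M →ₗ[B] TensorOver k A (DualBimodule k M) X :=
          TensorOver.map (DualBimodule k M) B
            { toFun := fun m => φ (TensorOver.tmul k B m v)
              map_add' := fun m n => by rw [TensorOver.add_tmul, map_add]
              map_smul' := fun a m => by rw [← TensorOver.smul_tmul', map_smul]; rfl }
        have h := congrArg ψ (sum_formComp_tmul_op_smul M hs b)
        simp only [map_sum] at h
        rw [RingHom.id_apply, Finset.smul_sum]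
        simp only [← TensorOver.smul_tmul]
        exact h }
  map_add' φ φ' := by
    ext v
    simp [TensorOver.tmul_add, Finset.sum_add_distrib]
  map_smul' c φ := by
    ext v
    simp [Finset.smul_sum, TensorOver.smul_tmul', TensorOver.smul_tmul_base]

variable {M X V} in
/-- The adjunction sends `y ↦ γ(y) x` to `v ↦ (s ∘ γ_v) ⊗ x`, where `γ_v(m) = γ(m ⊗ v)`. -/
theorem adjunctionHom_smulRight (hs : IsSymmetrisingForm s) (γ : TensorOver k B M V →ₗ[A] A)
    (x : X) (v : V) (γv : M →ₗ[A] A) (hγv : ∀ m, γv m = γ (TensorOver.tmul k B m v)) :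
    adjunctionHom M X V hs (γ.smulRight x) v = TensorOver.tmul k A (formComp s γv) x := by
  change ∑ i, TensorOver.tmul k A (formComp s ((dualBasis A M).coord i))
    (γ (TensorOver.tmul k B ((dualBasis A M).vec i) v) • x) = _
  simp only [← TensorOver.smul_tmul, ← hγv]
  rw [← TensorOver.sum_tmul]
  congr 1
  ext m
  rw [DualBimodule.sum_apply]
  conv_rhs => rw [formComp_apply, ← (dualBasis A M).sum_smul m]
  simp only [DualBimodule.right_smul_apply, formComp_apply, MulOpposite.unop_op, map_smul,
    smul_eq_mul, map_sum]
  exact Finset.sum_congr rfl fun i _ => hs.mul_comm _ _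

end Unit

section Counit

variable [Module.Finite Bᵐᵒᵖ M] [Module.Projective Bᵐᵒᵖ M]

theorem sum_smul_tmul_formCompOp (ht : IsSymmetrisingForm t) (a : A) :
    ∑ j, TensorOver.tmul k B (a • (dualBasis Bᵐᵒᵖ M).vec j)
      (formCompOp t ((dualBasis Bᵐᵒᵖ M).coord j)) =
    ∑ j, TensorOver.tmul k B ((dualBasis Bᵐᵒᵖ M).vec j)
      (op a • formCompOp t ((dualBasis Bᵐᵒᵖ M).coord j)) := by
  have h1 : ∀ j, TensorOver.tmul k B (a • (dualBasis Bᵐᵒᵖ M).vec j)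
      (formCompOp t ((dualBasis Bᵐᵒᵖ M).coord j)) =
      ∑ l, TensorOver.tmul k B ((dualBasis Bᵐᵒᵖ M).vec l)
        (unop ((dualBasis Bᵐᵒᵖ M).coord l (a • (dualBasis Bᵐᵒᵖ M).vec j)) •
          formCompOp t ((dualBasis Bᵐᵒᵖ M).coord j)) := by
    intro j
    conv_lhs => rw [← (dualBasis Bᵐᵒᵖ M).sum_smul (a • (dualBasis Bᵐᵒᵖ M).vec j)]
    rw [TensorOver.sum_tmul]
    exact Finset.sum_congr rfl fun l _ => TensorOver.smul_tmul k B
      (unop ((dualBasis Bᵐᵒᵖ M).coord l (a • (dualBasis Bᵐᵒᵖ M).vec j))) _ _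
  rw [Finset.sum_congr rfl fun j _ => h1 j, Finset.sum_comm]
  refine Finset.sum_congr rfl fun l _ => ?_
  rw [← TensorOver.tmul_sum]
  congr 1
  ext m
  rw [DualBimodule.sum_apply]
  simp only [DualBimodule.right_smul_apply, DualBimodule.left_smul_apply, formCompOp_apply,
    MulOpposite.unop_op, MulOpposite.op_unop, map_smul, smul_eq_mul, MulOpposite.unop_mul]
  conv_rhs => rw [← (dualBasis Bᵐᵒᵖ M).sum_smul m, Finset.smul_sum]
  rw [map_sum, Finset.unop_sum, map_sum]
  refine Finset.sum_congr rfl fun j _ => ?_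
  rw [smul_comm a ((dualBasis Bᵐᵒᵖ M).coord j m),
    ((dualBasis Bᵐᵒᵖ M).coord l).map_smul ((dualBasis Bᵐᵒᵖ M).coord j m), smul_eq_mul,
    MulOpposite.unop_mul, ht.mul_comm]

/-- The adjunction isomorphism `Hom_B(M^∨ ⊗_A X, V) ≅ Hom_A(X, M ⊗_B V)`,
`ψ ↦ (x ↦ ∑ m_j ⊗ ψ((t ∘ β_j) ⊗ x))`, given by the unit of the adjunction, where
`β_j : M → B` are homomorphisms of right `B`-modules with `∑ m_j β_j(m) = m` for all `m ∈ M`. -/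
noncomputable def adjunctionHom' (ht : IsSymmetrisingForm t) :
    (TensorOver k A (DualBimodule k M) X →ₗ[B] V) →ₗ[k] (X →ₗ[A] TensorOver k B M V) where
  toFun ψ :=
    { toFun := fun x => ∑ j, TensorOver.tmul k B ((dualBasis Bᵐᵒᵖ M).vec j)
        (ψ (TensorOver.tmul k A (formCompOp t ((dualBasis Bᵐᵒᵖ M).coord j)) x))
      map_add' := fun x y => by
        simp only [TensorOver.tmul_add, map_add, Finset.sum_add_distrib]
      map_smul' := fun a x => by
        let θ : TensorOver k B M (DualBimodule k M) →ₗ[A] TensorOver k B M V :=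
          TensorOver.map M A
            { toFun := fun μ => ψ (TensorOver.tmul k A μ x)
              map_add' := fun μ ν => by rw [TensorOver.add_tmul, map_add]
              map_smul' := fun b μ => by rw [← TensorOver.smul_tmul', map_smul]; rfl }
        have h := congrArg θ (sum_smul_tmul_formCompOp M ht a)
        simp only [map_sum] at h
        rw [RingHom.id_apply, Finset.smul_sum]
        simp only [← TensorOver.smul_tmul]
        exact h.symm }
  map_add' ψ ψ' := by
    ext x
    simp [TensorOver.tmul_add, Finset.sum_add_distrib]
  map_smul' c ψ := by
    ext x
    simp [Finset.smul_sum, TensorOver.smul_tmul', TensorOver.smul_tmul_base]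

/-- If `B` is symmetric and `M` is finitely generated projective as right `B`-module, then `M^∨` is
projective as left `B`-module. -/
theorem DualBimodule.projective (ht : IsSymmetrisingForm t) :
    Module.Projective B (DualBimodule k M) := by
  have hrep : ∀ (μ : DualBimodule k M) (j : Fin (dualBasis Bᵐᵒᵖ M).n), ∃ b : B,
      ∀ x, t (b * x) = μ (op x • (dualBasis Bᵐᵒᵖ M).vec j) := fun μ j =>
    ht.exists_rep
      { toFun := fun x => μ (op x • (dualBasis Bᵐᵒᵖ M).vec j)
        map_add' := fun x y => by rw [MulOpposite.op_add, add_smul, map_add]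
        map_smul' := fun c x => by rw [MulOpposite.op_smul, smul_assoc, map_smul]; rfl }
  choose f hf using hrep
  let i : DualBimodule k M →ₗ[B] (Fin (dualBasis Bᵐᵒᵖ M).n → B) :=
    { toFun := f
      map_add' := fun μ ν => by
        ext j
        refine ht.ext_left fun x => ?_
        rw [hf, Pi.add_apply, add_mul, map_add, hf, hf, DualBimodule.add_apply]
      map_smul' := fun b μ => by
        ext j
        refine ht.ext_left fun x => ?_
        rw [hf, RingHom.id_apply, Pi.smul_apply, smul_eq_mul, mul_assoc, ht.mul_comm, mul_assoc,
          hf, DualBimodule.left_smul_apply, MulOpposite.op_mul, mul_smul] }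
  let r : (Fin (dualBasis Bᵐᵒᵖ M).n → B) →ₗ[B] DualBimodule k M :=
    { toFun := fun c => ∑ j, c j • formCompOp t ((dualBasis Bᵐᵒᵖ M).coord j)
      map_add' := fun c d => by simp [add_smul, Finset.sum_add_distrib]
      map_smul' := fun b c => by simp [mul_smul, Finset.smul_sum] }
  refine Module.Projective.of_split i r ?_
  ext μ m
  change (∑ j, f μ j • formCompOp t ((dualBasis Bᵐᵒᵖ M).coord j) : DualBimodule k M) m = μ m
  rw [DualBimodule.sum_apply]
  conv_rhs => rw [← (dualBasis Bᵐᵒᵖ M).sum_smul m, map_sum]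
  refine Finset.sum_congr rfl fun j _ => ?_
  rw [DualBimodule.left_smul_apply, formCompOp_apply, map_smul, smul_eq_mul, MulOpposite.unop_mul,
    MulOpposite.unop_op, ht.mul_comm, hf, MulOpposite.op_unop]

end Counit

/-- The adjunction isomorphism `Hom_A(M ⊗_B V, X) ≅ Hom_B(V, M^∨ ⊗_A X)` in the stable module
categories. -/
noncomputable def stableAdjunction [Module.Finite A M] [Module.Projective A M]
    [Module.Finite Bᵐᵒᵖ M] [Module.Projective Bᵐᵒᵖ M] (hs : IsSymmetrisingForm s)
    (ht : IsSymmetrisingForm t) :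
    StableHom k A (TensorOver k B M V) X →ₗ[k]
      StableHom k B V (TensorOver k A (DualBimodule k M) X) :=
  Submodule.mapQ _ _ (adjunctionHom M X V hs) (by
    rintro _ ⟨P, _, _, g, h, hP, rfl⟩
    letI : Module k P := Module.compHom P (algebraMap k A)
    haveI : IsScalarTower k A P := .of_algebraMap_smul fun _ _ => rfl
    haveI := DualBimodule.projective (k := k) (B := B) M ht
    have h1 : adjunctionHom M X V hs (h ∘ₗ g) =
        TensorOver.map (DualBimodule k M) B h ∘ₗ adjunctionHom M P V hs g := by
      ext v
      simp [adjunctionHom]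
    rw [Submodule.mem_comap, h1]
    exact comp_mem_projHom k _ _)

/-- The adjunction isomorphism `Hom_B(M^∨ ⊗_A X, V) ≅ Hom_A(X, M ⊗_B V)` in the stable module
categories. -/
noncomputable def stableAdjunction' [Module.Projective A M]
    [Module.Finite Bᵐᵒᵖ M] [Module.Projective Bᵐᵒᵖ M] (ht : IsSymmetrisingForm t) :
    StableHom k B (TensorOver k A (DualBimodule k M) X) V →ₗ[k]
      StableHom k A X (TensorOver k B M V) :=
  Submodule.mapQ _ _ (adjunctionHom' M X V ht) (by
    rintro _ ⟨P, _, _, g, h, hP, rfl⟩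
    letI : Module k P := Module.compHom P (algebraMap k B)
    haveI : IsScalarTower k B P := .of_algebraMap_smul fun _ _ => rfl
    have h1 : adjunctionHom' M X V ht (h ∘ₗ g) =
        TensorOver.map M A h ∘ₗ adjunctionHom' M X P ht g := by
      ext v
      simp [adjunctionHom']
    rw [Submodule.mem_comap, h1]
    exact comp_mem_projHom k _ _)

end Adjunction

/-! ### Comparison of `M^∨ ⊗_A Ω(U)` and `Ω(M^∨ ⊗_A U)` -/

section Omega

variable {k : Type*} [Field k] {A : Type*} [Ring A] [Algebra k A] {B : Type*} [Ring B]
  [Algebra k B]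
variable {M : Type*} [AddCommGroup M] [Module k M] [Module A M] [Module Bᵐᵒᵖ M]
  [IsScalarTower k A M] [IsScalarTower k Bᵐᵒᵖ M] [SMulCommClass A Bᵐᵒᵖ M]
variable {U : Type*} [AddCommGroup U] [Module k U] [Module A U] [IsScalarTower k A U]
variable {P : Type*} [AddCommGroup P] [Module k P] [Module A P] [IsScalarTower k A P]
variable {Q : Type*} [AddCommGroup Q] [Module B Q]

/-- For homomorphisms `π : P → U`, `ρ : Q → M^∨ ⊗_A U` and `h : M^∨ ⊗_A P → Q` with
`ρ ∘ h = Id ⊗ π`, the map `M^∨ ⊗_A ker π → ker ρ` induced by `h`. -/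
noncomputable def omegaComparison (π : P →ₗ[A] U)
    (ρ : Q →ₗ[B] TensorOver k A (DualBimodule k M) U)
    (h : TensorOver k A (DualBimodule k M) P →ₗ[B] Q)
    (hh : ρ ∘ₗ h = TensorOver.map (DualBimodule k M) B π) :
    TensorOver k A (DualBimodule k M) (LinearMap.ker π) →ₗ[B] LinearMap.ker ρ :=
  LinearMap.codRestrict _
    (h ∘ₗ TensorOver.map (DualBimodule k M) B (LinearMap.ker π).subtype) (by
      intro x
      rw [LinearMap.mem_ker, LinearMap.comp_apply, ← LinearMap.comp_apply ρ h, hh]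
      induction x using TensorOver.induction_on with
      | zero => simp
      | tmul μ u => simp [TensorOver.tmul_zero]
      | add x y hx hy => rw [map_add, map_add, hx, hy, add_zero])

end Omega

end TateDuality

open TateDuality

/-!
Over a symmetric algebra `A` with form `s`, composition with `s` identifies `Hom_A(X, A)` with
`X^∨` (`repHom`). All parts of the theorem rest on this.

*Tate duality.* For `P` finitely generated projective, `β ↦ β^` is an isomorphism
`Hom_A(V, P) ≅ Hom_A(P, V)^∨`, natural in `P` (`homDual_injective`, `homDual_surjective`,
`homDual_comp`). A form on `Hom_A(U, V)` extends along `π` to `Hom_A(P, V)`, hence is `β^` for some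
`β : V → P`; it vanishes on the maps that factor through `A` only if `π ∘ β = 0`. Conversely, if
the form of `β : V → ker π` vanishes on `Hom_A(U, V)`, then it factors through
`Hom_A(P, V) → Hom_A(F, V)` for a free cover `F` of `ker π`, and representing the resulting form on
`Hom_A(F, V)` gives a factorisation of `β` through `F`.

*Adjunctions.* The identifications `M^∨ ≅ Hom_A(M, A)` and `M^∨ ≅ Hom(M_B, B)` give pairings
`M × M^∨ → A` and `M^∨ × M → B`. These yield the counits (`evalAt`, `evalAtOp`) that invert the two
adjunctions; by naturality the inverses respect maps that factor through projectives. Evaluation at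
a generating system of `M` also makes `M^∨ ⊗_A X` a natural summand of `X^n`, whence the exactness
of `M^∨ ⊗_A -`. Different choices of syzygies are compared by lifting against projectives, as in
Schanuel's lemma (`stablePostcomp_omegaComparison_bijective`).

*Commutativity.* Naturality of `β ↦ β^` and of the adjunctions reduces the claim to an identity of
forms for `β : M ⊗_B V → P` and `χ : M^∨ ⊗_A P → V` (`homDual_adjunctionHom`). By additivity
`β = (y ↦ γ(y) p)`, and then both sides are `∑ s(γ(n_j ⊗ χ((t ∘ β_j) ⊗ p)))`; on the side of `B`
this uses the dual basis of `M^∨` formed by the `t ∘ β_j` and the pairing with the `n_j`.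
-/

namespace TateDuality

/-! ### Linear forms and homomorphisms into a symmetric algebra -/

section Representation

variable {k : Type*} [Field k] {A : Type*} [Ring A] [Algebra k A] {s : Module.Dual k A}
variable {X : Type*} [AddCommGroup X] [Module k X]

theorem IsSymmetrisingForm.exists_linearMap [Module A X] [IsScalarTower k A X]
    (hs : IsSymmetrisingForm s) (f : Module.Dual k X) :
    ∃ α : X →ₗ[A] A, ∀ x, s (α x) = f x := by
  have hrep : ∀ x : X, ∃ a : A, ∀ c, s (a * c) = f (c • x) := fun x =>
    hs.exists_rep
      { toFun := fun c => f (c • x)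
        map_add' := fun c d => by rw [add_smul, map_add]
        map_smul' := fun c d => by rw [smul_assoc, map_smul]; rfl }
  choose α hα using hrep
  refine ⟨⟨⟨α, fun x y => hs.ext_left fun c => ?_⟩, fun a x => hs.ext_left fun c => ?_⟩,
    fun x => ?_⟩
  · rw [hα, add_mul, map_add, hα, hα, smul_add, map_add]
  · rw [hα, RingHom.id_apply, smul_eq_mul, mul_assoc, hs.mul_comm, mul_assoc, hα, mul_smul]
  · have h := hα x 1
    rwa [mul_one, one_smul] at h

/-- A symmetrising form detects elements of `A`, and hence `A`-linear maps into `A`. -/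
theorem IsSymmetrisingForm.linearMap_ext [Module A X] (hs : IsSymmetrisingForm s)
    {α β : X →ₗ[A] A} (h : ∀ x, s (α x) = s (β x)) : α = β := by
  ext x
  refine hs.ext_left fun c => ?_
  rw [hs.mul_comm, hs.mul_comm (β x), ← smul_eq_mul, ← smul_eq_mul, ← map_smul, ← map_smul, h]

/-- The `A`-linear map `X → A` that corresponds to a linear form `f` on `X` under the
isomorphism `Hom_A(X, A) ≅ X^∨`, `α ↦ s ∘ α`. -/
noncomputable def repHom [Module A X] [IsScalarTower k A X]
    (hs : IsSymmetrisingForm s) (f : Module.Dual k X) : X →ₗ[A] A :=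
  (hs.exists_linearMap f).choose

@[simp] theorem form_repHom [Module A X] [IsScalarTower k A X]
    (hs : IsSymmetrisingForm s) (f : Module.Dual k X) (x : X) : s (repHom hs f x) = f x :=
  (hs.exists_linearMap f).choose_spec x

theorem IsSymmetrisingForm.exists_linearMap_op [Module Aᵐᵒᵖ X] [IsScalarTower k Aᵐᵒᵖ X]
    (hs : IsSymmetrisingForm s) (f : Module.Dual k X) :
    ∃ β : X →ₗ[Aᵐᵒᵖ] Aᵐᵒᵖ, ∀ x, s (unop (β x)) = f x := by
  have hrep : ∀ x : X, ∃ a : A, ∀ c, s (a * c) = f (op c • x) := fun x =>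
    hs.exists_rep
      { toFun := fun c => f (op c • x)
        map_add' := fun c d => by rw [MulOpposite.op_add, add_smul, map_add]
        map_smul' := fun c d => by rw [MulOpposite.op_smul, smul_assoc, map_smul]; rfl }
  choose β hβ using hrep
  refine ⟨⟨⟨fun x => op (β x), fun x y => ?_⟩, fun a x => ?_⟩, fun x => ?_⟩
  · rw [← MulOpposite.op_add]
    refine congrArg op (hs.ext_left fun c => ?_)
    rw [hβ, add_mul, map_add, hβ, hβ, smul_add, map_add]
  · refine MulOpposite.unop_injective (hs.ext_left fun c => ?_)
    simp only [MulOpposite.unop_op, RingHom.id_apply, smul_eq_mul, MulOpposite.unop_mul]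
    rw [hβ, mul_assoc, hβ, MulOpposite.op_mul, MulOpposite.op_unop, mul_smul]
  · have h := hβ x 1
    rwa [mul_one, MulOpposite.op_one, one_smul] at h

theorem IsSymmetrisingForm.linearMap_op_ext [Module Aᵐᵒᵖ X] (hs : IsSymmetrisingForm s)
    {α β : X →ₗ[Aᵐᵒᵖ] Aᵐᵒᵖ} (h : ∀ x, s (unop (α x)) = s (unop (β x))) : α = β := by
  ext x
  refine MulOpposite.unop_injective (hs.ext_left fun c => ?_)
  have h1 := h (op c • x)
  simpa using h1

/-- The homomorphism of right `A`-modules `X → A` that corresponds to a linear form `f` on `X`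
under the isomorphism `α ↦ s ∘ α`; as in `formCompOp`, it is given as a homomorphism
`X → Aᵐᵒᵖ` of left `Aᵐᵒᵖ`-modules. -/
noncomputable def repHomOp [Module Aᵐᵒᵖ X] [IsScalarTower k Aᵐᵒᵖ X]
    (hs : IsSymmetrisingForm s) (f : Module.Dual k X) : X →ₗ[Aᵐᵒᵖ] Aᵐᵒᵖ :=
  (hs.exists_linearMap_op f).choose

@[simp] theorem form_repHomOp [Module Aᵐᵒᵖ X] [IsScalarTower k Aᵐᵒᵖ X]
    (hs : IsSymmetrisingForm s) (f : Module.Dual k X) (x : X) :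
    s (unop (repHomOp hs f x)) = f x :=
  (hs.exists_linearMap_op f).choose_spec x

/-- Elements of `X` are detected by the `A`-linear maps `X → A`, composed with a symmetrising
form. -/
theorem IsSymmetrisingForm.eq_zero_of_forall_form [Module A X] [IsScalarTower k A X]
    (hs : IsSymmetrisingForm s) {x : X} (h : ∀ α : X →ₗ[A] A, s (α x) = 0) : x = 0 := by
  exact (Module.forall_dual_apply_eq_zero_iff k x).1 fun f => by rw [← form_repHom hs, h]

end Representation

/-! ### Bijectivity of Tate duality -/

section Tate

variable {k : Type*} [Field k] {A : Type*} [Ring A] [Algebra k A] {s : Module.Dual k A}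
variable {P : Type*} [AddCommGroup P] [Module k P] [Module A P] [IsScalarTower k A P]
  [Module.Finite A P] [Module.Projective A P]
variable {P' : Type*} [AddCommGroup P'] [Module k P'] [Module A P'] [IsScalarTower k A P']
  [Module.Finite A P'] [Module.Projective A P']
variable {V : Type*} [AddCommGroup V] [Module k V] [Module A V] [IsScalarTower k A V]
variable {U : Type*} [AddCommGroup U] [Module k U] [Module A U] [IsScalarTower k A U]

/-- Precomposition with a homomorphism of `A`-modules as a `k`-linear map. -/
def precompₗ (V : Type*) [AddCommGroup V] [Module k V] [Module A V] [IsScalarTower k A V]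
    (g : U →ₗ[A] P) : (P →ₗ[A] V) →ₗ[k] (U →ₗ[A] V) where
  toFun f := f ∘ₗ g
  map_add' f f' := by ext; simp
  map_smul' c f := by ext; simp

@[simp] theorem precompₗ_apply (g : U →ₗ[A] P) (f : P →ₗ[A] V) :
    precompₗ (k := k) V g f = f ∘ₗ g := rfl

/-- The construction `β ↦ β^` is natural in `P`. -/
theorem homDual_comp (hs : IsSymmetrisingForm s) (θ : P →ₗ[A] P') (β : V →ₗ[A] P)
    (f : P' →ₗ[A] V) : homDual s P' V (θ ∘ₗ β) f = homDual s P V β (f ∘ₗ θ) := by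
  have h := homDual_unique hs (θ ∘ₗ β) (homDual s P V β ∘ₗ precompₗ V θ) fun α v => by
    have h1 : (α.smulRight v) ∘ₗ θ = (α ∘ₗ θ).smulRight v := by ext; simp
    rw [LinearMap.comp_apply, precompₗ_apply, h1, homDual_smulRight hs]
    rfl
  exact (congrArg (fun φ : Module.Dual k (P' →ₗ[A] V) => φ f) h).symm

/-- The form `β^` of a homomorphism `β = (v ↦ γ(v) p)`. -/
theorem homDual_smulRight_left (hs : IsSymmetrisingForm s) (γ : V →ₗ[A] A) (p : P)
    (f : P →ₗ[A] V) : homDual s P V (γ.smulRight p) f = s (γ (f p)) := by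
  rw [homDual_apply]
  conv_rhs => rw [← (dualBasis A P).sum_smul p]
  simp only [map_sum, map_smul, LinearMap.smulRight_apply, smul_eq_mul]
  exact Finset.sum_congr rfl fun i _ => hs.mul_comm _ _

theorem eq_sum_smulRight (β : V →ₗ[A] P) :
    β = ∑ i, ((dualBasis A P).coord i ∘ₗ β).smulRight ((dualBasis A P).vec i) := by
  ext v
  conv_lhs => rw [← (dualBasis A P).sum_smul (β v)]
  simp

theorem homDual_injective (hs : IsSymmetrisingForm s) :
    Function.Injective (homDual s P V) := by
  rw [injective_iff_map_eq_zero]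
  intro β hβ
  ext v
  refine hs.eq_zero_of_forall_form (k := k) fun α => ?_
  rw [← homDual_smulRight hs, hβ, LinearMap.zero_apply]

/-- A form `φ` on `Hom_A(P, V)` is `β^`, where the coordinates of `β` represent the forms
`v ↦ φ(x ↦ α_i(x) v)` for a dual basis of `P` with coordinates `α_i`. -/
theorem homDual_surjective (hs : IsSymmetrisingForm s) :
    Function.Surjective (homDual s P V) := by
  intro φ
  let F : Fin (dualBasis A P).n → Module.Dual k V := fun i =>
    { toFun := fun v => φ (((dualBasis A P).coord i).smulRight v)
      map_add' := fun v w => by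
        rw [← map_add]; congr 1; ext; simp
      map_smul' := fun c v => by
        rw [← map_smul]
        congr 1
        ext x
        exact smul_comm ((dualBasis A P).coord i x) c v }
  refine ⟨∑ i, (repHom hs (F i)).smulRight ((dualBasis A P).vec i), ?_⟩
  refine (homDual_unique hs _ φ fun α v => ?_).symm
  have h1 : α.smulRight v =
      ∑ i, ((dualBasis A P).coord i).smulRight (α ((dualBasis A P).vec i) • v) := by
    ext x
    conv_lhs => rw [← (dualBasis A P).sum_smul x]
    simp only [map_sum, map_smul, LinearMap.smulRight_apply, LinearMap.sum_apply]
  rw [h1, map_sum]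
  simp only [LinearMap.sum_apply, map_sum, LinearMap.smulRight_apply, map_smul, smul_eq_mul]
  refine Finset.sum_congr rfl fun i _ => ?_
  rw [hs.mul_comm, ← smul_eq_mul, ← map_smul, form_repHom]
  rfl

/-- A linear form that vanishes on the kernel of `g` factors through `g`. -/
theorem exists_dual_comp_eq {Y Z : Type*} [AddCommGroup Y] [Module k Y] [AddCommGroup Z]
    [Module k Z] (g : Y →ₗ[k] Z) (φ : Module.Dual k Y) (h : ∀ y, g y = 0 → φ y = 0) :
    ∃ ψ : Module.Dual k Z, ∀ y, ψ (g y) = φ y := by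
  have h1 : φ ∈ LinearMap.range g.dualMap := by
    rw [LinearMap.range_dualMap_eq_dualAnnihilator_ker, Submodule.mem_dualAnnihilator]
    exact fun y hy => h y hy
  obtain ⟨ψ, rfl⟩ := h1
  exact ⟨ψ, fun _ => rfl⟩

theorem exists_comp_eq_of_surjective {π : P →ₗ[A] U} (hπ : Function.Surjective π)
    (f : P →ₗ[A] V) (hf : ∀ x ∈ LinearMap.ker π, f x = 0) : ∃ g : U →ₗ[A] V, g ∘ₗ π = f :=
  ⟨(LinearMap.ker π).liftQ f hf ∘ₗ (π.quotKerEquivOfSurjective hπ).symm, by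
    ext x
    have : (π.quotKerEquivOfSurjective hπ).symm (π x) = Submodule.Quotient.mk x := by
      rw [LinearEquiv.symm_apply_eq]; rfl
    rw [LinearMap.comp_apply, LinearMap.comp_apply, LinearEquiv.coe_coe, this]
    exact Submodule.liftQ_apply _ _ _⟩

theorem tateDuality_injective (hs : IsSymmetrisingForm s) [Module.Finite k A]
    [Module.Finite A V] {π : P →ₗ[A] U} (hπ : Function.Surjective π) :
    Function.Injective (tateDuality V hs π) := by
  haveI : IsNoetherianRing A := isNoetherian_of_tower k (inferInstance : IsNoetherian k A)
  rw [injective_iff_map_eq_zero]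
  intro x hx
  obtain ⟨β, rfl⟩ := Submodule.Quotient.mk_surjective _ x
  have hβ : ∀ f : U →ₗ[A] V, homDual s P V ((LinearMap.ker π).subtype ∘ₗ β) (f ∘ₗ π) = 0 :=
    fun f => by rw [← tateDuality_mk hs, hx, LinearMap.zero_apply]
  -- A free cover `q` of `ker π`: the form of `β` factors through composition with `q`, and the
  -- resulting form on `Hom(Aⁿ, V)` is represented by a factorisation of `β` through `q`.
  obtain ⟨n, q, hq⟩ := Module.Finite.exists_fin' A (LinearMap.ker π)
  obtain ⟨ψ, hψ⟩ := exists_dual_comp_eq (precompₗ V ((LinearMap.ker π).subtype ∘ₗ q))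
    (homDual s P V ((LinearMap.ker π).subtype ∘ₗ β)) (fun f hf => by
      obtain ⟨g, rfl⟩ := exists_comp_eq_of_surjective hπ f fun x hx => by
        obtain ⟨y, hy⟩ := hq ⟨x, hx⟩
        have := congrArg (fun l : (Fin n → A) →ₗ[A] V => l y) hf
        simpa [hy] using this
      exact hβ g)
  obtain ⟨γ, rfl⟩ := homDual_surjective hs ψ
  have h1 : (LinearMap.ker π).subtype ∘ₗ β = ((LinearMap.ker π).subtype ∘ₗ q) ∘ₗ γ := by
    apply homDual_injective hs
    ext f
    rw [homDual_comp hs _ γ, ← hψ]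
    rfl
  have h2 : β = q ∘ₗ γ := by
    ext v
    exact congrArg (fun l : V →ₗ[A] P => l v) h1
  rw [Submodule.Quotient.mk_eq_zero, h2]
  exact comp_mem_projHom k γ q

theorem tateDuality_surjective (hs : IsSymmetrisingForm s) [Module.Finite k A]
    [Module.Finite A V] {π : P →ₗ[A] U} (hπ : Function.Surjective π) :
    Function.Surjective (tateDuality V hs π) := by
  intro φ
  obtain ⟨ψ, hψ⟩ := exists_dual_comp_eq (precompₗ V π) (φ ∘ₗ (projHom k A U V).mkQ)
    (fun f hf => by
      have : f = 0 := by
        ext u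
        obtain ⟨p, rfl⟩ := hπ u
        exact congrArg (fun l : P →ₗ[A] V => l p) hf
      rw [this, map_zero])
  obtain ⟨β, rfl⟩ := homDual_surjective hs ψ
  -- The image of `β` lies in `ker π`, because `φ` vanishes on the maps that factor through `A`.
  have hβ : ∀ v, β v ∈ LinearMap.ker π := fun v => by
    rw [LinearMap.mem_ker]
    refine hs.eq_zero_of_forall_form (k := k) fun α => ?_
    have h1 := homDual_smulRight hs β (α ∘ₗ π) v
    have h2 : (α ∘ₗ π).smulRight v = precompₗ (k := k) V π (α.smulRight v) := rfl
    have h3 : α.smulRight v ∈ projHom k A U V := by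
      have : α.smulRight v = (LinearMap.toSpanSingleton A V v) ∘ₗ α := by ext; simp
      rw [this]
      exact comp_mem_projHom k _ _
    rw [h2, hψ, LinearMap.comp_apply, Submodule.mkQ_apply,
      (Submodule.Quotient.mk_eq_zero _).2 h3, map_zero] at h1
    exact h1.symm
  refine ⟨Submodule.Quotient.mk (β.codRestrict _ hβ), ?_⟩
  ext f
  exact hψ f

end Tate

/-! ### The evaluation maps of the two adjunctions -/

section Evaluation

variable {k : Type*} [Field k] {A : Type*} [Ring A] [Algebra k A] {B : Type*} [Ring B]
  [Algebra k B]
variable {s : Module.Dual k A} {t : Module.Dual k B}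
variable {M : Type*} [AddCommGroup M] [Module k M] [Module A M] [Module Bᵐᵒᵖ M]
  [IsScalarTower k A M] [IsScalarTower k Bᵐᵒᵖ M] [SMulCommClass A Bᵐᵒᵖ M]
variable {X : Type*} [AddCommGroup X] [Module k X] [Module A X] [IsScalarTower k A X]
variable {Y : Type*} [AddCommGroup Y] [Module k Y] [Module A Y] [IsScalarTower k A Y]
variable {V : Type*} [AddCommGroup V] [Module k V] [Module B V] [IsScalarTower k B V]
variable {W : Type*} [AddCommGroup W] [Module k W] [Module B W] [IsScalarTower k B W]

/-- The pairing `M × M^∨ → A` determined by `s(a ⟨m, μ⟩) = μ(a m)`. -/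
noncomputable def pairing (hs : IsSymmetrisingForm s) (μ : DualBimodule k M) : M →ₗ[A] A :=
  repHom hs (X := M) (μ : Module.Dual k M)

theorem form_pairing (hs : IsSymmetrisingForm s) (μ : DualBimodule k M) (m : M) :
    s (pairing hs μ m) = μ m :=
  form_repHom hs (X := M) (μ : Module.Dual k M) m

theorem pairing_eq (hs : IsSymmetrisingForm s) (μ : DualBimodule k M) (α : M →ₗ[A] A)
    (h : ∀ m, s (α m) = μ m) : pairing hs μ = α :=
  hs.linearMap_ext fun m => by rw [form_pairing, h]

theorem pairing_formComp (hs : IsSymmetrisingForm s) (α : M →ₗ[A] A) :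
    pairing hs (formComp s α) = α :=
  pairing_eq hs _ _ fun _ => rfl

theorem pairing_add (hs : IsSymmetrisingForm s) (μ ν : DualBimodule k M) :
    pairing hs (μ + ν) = pairing hs μ + pairing hs ν :=
  pairing_eq hs _ _ fun m => by simp [form_pairing]

theorem pairing_base_smul (hs : IsSymmetrisingForm s) (c : k) (μ : DualBimodule k M) :
    pairing hs (c • μ) = c • pairing hs μ :=
  pairing_eq hs _ _ fun m => by simp [form_pairing]

theorem pairing_op_smul (hs : IsSymmetrisingForm s) (a : A) (μ : DualBimodule k M) (m : M) :
    pairing hs (op a • μ) m = pairing hs μ m * a :=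
  congrArg (fun f : M →ₗ[A] A => f m)
    (pairing_eq hs (op a • μ) ((pairing hs μ).smulRight a) fun m => by
      rw [LinearMap.smulRight_apply, smul_eq_mul, hs.mul_comm, ← smul_eq_mul, ← map_smul,
        form_pairing]
      rfl)

theorem pairing_smul (hs : IsSymmetrisingForm s) (b : B) (μ : DualBimodule k M) (m : M) :
    pairing hs (b • μ) m = pairing hs μ (op b • m) :=
  congrArg (fun f : M →ₗ[A] A => f m)
    (pairing_eq hs (b • μ)
      { toFun := fun m => pairing hs μ (op b • m)
        map_add' := fun m n => by rw [smul_add, map_add]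
        map_smul' := fun a m => by rw [← smul_comm a (op b) m, map_smul]; rfl }
      fun m => form_pairing hs μ (op b • m))

/-- The evaluation `M^∨ ⊗_A X → X`, `μ ⊗ x ↦ ⟨m, μ⟩ x`, at an element `m` of `M`. As `m` varies,
this is the counit `M ⊗_B M^∨ ⊗_A X → X` of the adjunction of `M ⊗_B -` and `M^∨ ⊗_A -`. -/
noncomputable def evalAt (hs : IsSymmetrisingForm s) (m : M) :
    TensorOver k A (DualBimodule k M) X →+ X :=
  TensorOver.lift
    { toFun := fun μ =>
        { toFun := fun x => pairing hs μ m • x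
          map_zero' := smul_zero _
          map_add' := fun x y => smul_add _ x y }
      map_zero' := by
        ext x
        have h : pairing hs (0 : DualBimodule k M) = 0 := pairing_eq hs _ _ fun m => by simp
        simp [h]
      map_add' := fun μ ν => by ext x; simp [pairing_add, add_smul] }
    (fun c μ x => by
      change pairing hs (c • μ) m • x = pairing hs μ m • c • x
      rw [pairing_base_smul, LinearMap.smul_apply, smul_assoc, smul_comm])
    (fun a μ x => by
      change pairing hs (op a • μ) m • x = pairing hs μ m • a • x
      rw [pairing_op_smul, mul_smul])

@[simp] theorem evalAt_tmul (hs : IsSymmetrisingForm s) (m : M) (μ : DualBimodule k M) (x : X) :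
    evalAt hs m (TensorOver.tmul k A μ x) = pairing hs μ m • x := rfl

theorem evalAt_add (hs : IsSymmetrisingForm s) (m n : M)
    (y : TensorOver k A (DualBimodule k M) X) :
    evalAt hs (m + n) y = evalAt hs m y + evalAt hs n y := by
  induction y using TensorOver.induction_on with
  | zero => simp
  | tmul μ x => simp [add_smul]
  | add x y hx hy => rw [map_add, hx, hy, map_add, map_add]; abel

theorem evalAt_smul (hs : IsSymmetrisingForm s) (a : A) (m : M)
    (y : TensorOver k A (DualBimodule k M) X) : evalAt hs (a • m) y = a • evalAt hs m y := by
  induction y using TensorOver.induction_on with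
  | zero => simp
  | tmul μ x => simp [mul_smul]
  | add x y hx hy => rw [map_add, hx, hy, map_add, smul_add]

theorem evalAt_op_smul (hs : IsSymmetrisingForm s) (b : B) (m : M)
    (y : TensorOver k A (DualBimodule k M) X) : evalAt hs (op b • m) y = evalAt hs m (b • y) := by
  induction y using TensorOver.induction_on with
  | zero => simp
  | tmul μ x => rw [TensorOver.smul_tmul', evalAt_tmul, evalAt_tmul, pairing_smul]
  | add x y hx hy => rw [map_add, hx, hy, smul_add, map_add]

theorem evalAt_map (hs : IsSymmetrisingForm s) (m : M) (g : X →ₗ[A] Y)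
    (y : TensorOver k A (DualBimodule k M) X) :
    evalAt hs m (TensorOver.map (DualBimodule k M) B g y) = g (evalAt hs m y) := by
  induction y using TensorOver.induction_on with
  | zero => simp
  | tmul μ x => simp
  | add x y hx hy => simp only [map_add, hx, hy]

section DualBasis

variable [Module.Finite A M] [Module.Projective A M]

/-- Since `M` is finitely generated projective, an element of `M^∨ ⊗_A X` is determined by its
evaluations at a generating system of `M`: `M^∨ ⊗_A X` is naturally a summand of `X^n`. -/
theorem sum_formComp_tmul_evalAt (hs : IsSymmetrisingForm s)
    (y : TensorOver k A (DualBimodule k M) X) :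
    ∑ i, TensorOver.tmul k A (formComp s ((dualBasis A M).coord i))
      (evalAt hs ((dualBasis A M).vec i) y) = y := by
  induction y using TensorOver.induction_on with
  | zero => simp [TensorOver.tmul_zero]
  | tmul μ x =>
    simp only [evalAt_tmul, ← TensorOver.smul_tmul]
    rw [← TensorOver.sum_tmul]
    congr 1
    ext m
    rw [DualBimodule.sum_apply, ← form_pairing hs μ m]
    conv_rhs => rw [← (dualBasis A M).sum_smul m]
    simp only [DualBimodule.right_smul_apply, formComp_apply, MulOpposite.unop_op, map_smul,
      smul_eq_mul, map_sum]
    exact Finset.sum_congr rfl fun i _ => hs.mul_comm _ _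
  | add x y hx hy =>
    simp only [map_add, TensorOver.tmul_add, Finset.sum_add_distrib, hx, hy]

theorem adjunctionHom_apply (hs : IsSymmetrisingForm s) (φ : TensorOver k B M V →ₗ[A] X) (v : V) :
    adjunctionHom M X V hs φ v =
      ∑ i, TensorOver.tmul k A (formComp s ((dualBasis A M).coord i))
        (φ (TensorOver.tmul k B ((dualBasis A M).vec i) v)) := rfl

theorem evalAt_adjunctionHom (hs : IsSymmetrisingForm s) (φ : TensorOver k B M V →ₗ[A] X)
    (m : M) (v : V) :
    evalAt hs m (adjunctionHom M X V hs φ v) = φ (TensorOver.tmul k B m v) := by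
  rw [adjunctionHom_apply, map_sum]
  conv_rhs => rw [← (dualBasis A M).sum_smul m, TensorOver.sum_tmul, map_sum]
  refine Finset.sum_congr rfl fun i _ => ?_
  rw [evalAt_tmul, pairing_formComp, ← TensorOver.smul_tmul', map_smul]

theorem adjunctionHom_bijective (hs : IsSymmetrisingForm s) :
    Function.Bijective (adjunctionHom (B := B) M X V hs) := by
  constructor
  · intro φ φ' h
    ext y
    induction y using TensorOver.induction_on with
    | zero => simp
    | tmul m v => rw [← evalAt_adjunctionHom hs, h, evalAt_adjunctionHom]
    | add x y hx hy => rw [map_add, map_add, hx, hy]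
  · intro f
    let φ : TensorOver k B M V →+ X := TensorOver.lift
      { toFun := fun m => (evalAt hs m).comp (f : V →+ TensorOver k A (DualBimodule k M) X)
        map_zero' := by
          ext v
          have h := evalAt_smul hs 0 (0 : M) (f v)
          simpa using h
        map_add' := fun m n => by ext v; simp [evalAt_add] }
      (fun c m v => by
        change evalAt hs (c • m) (f v) = evalAt hs m (f (c • v))
        rw [← algebraMap_smul Bᵐᵒᵖ c m, ← algebraMap_smul B c v, map_smul, ← evalAt_op_smul]
        rfl)
      (fun b m v => by
        change evalAt hs (op b • m) (f v) = evalAt hs m (f (b • v))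
        rw [map_smul, evalAt_op_smul])
    refine ⟨⟨⟨φ, map_add φ⟩, fun a y => ?_⟩, ?_⟩
    · induction y using TensorOver.induction_on with
      | zero => simp
      | tmul m v => exact evalAt_smul hs a m (f v)
      | add x y hx hy => rw [smul_add]; simp_all
    · ext v
      exact sum_formComp_tmul_evalAt hs (f v)

theorem adjunctionHom_comp_map (hs : IsSymmetrisingForm s) (φ : TensorOver k B M W →ₗ[A] X)
    (g : V →ₗ[B] W) :
    adjunctionHom M X V hs (φ ∘ₗ TensorOver.map M A g) = adjunctionHom M X W hs φ ∘ₗ g := by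
  ext v
  simp [adjunctionHom_apply]

theorem adjunctionHom_comp (hs : IsSymmetrisingForm s) (φ : TensorOver k B M V →ₗ[A] X)
    (g : X →ₗ[A] Y) :
    adjunctionHom M Y V hs (g ∘ₗ φ) =
      TensorOver.map (DualBimodule k M) B g ∘ₗ adjunctionHom M X V hs φ := by
  ext v
  simp [adjunctionHom_apply]

end DualBasis

/-- The pairing `M^∨ × M → B` determined by `t(⟨μ, m⟩ b) = μ(m b)`, with values in `Bᵐᵒᵖ`, where
it is `Bᵐᵒᵖ`-linear in `m`. -/
noncomputable def pairingOp (ht : IsSymmetrisingForm t) (μ : DualBimodule k M) :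
    M →ₗ[Bᵐᵒᵖ] Bᵐᵒᵖ :=
  repHomOp ht (X := M) (μ : Module.Dual k M)

theorem form_pairingOp (ht : IsSymmetrisingForm t) (μ : DualBimodule k M) (m : M) :
    t (unop (pairingOp ht μ m)) = μ m :=
  form_repHomOp ht (X := M) (μ : Module.Dual k M) m

theorem pairingOp_eq (ht : IsSymmetrisingForm t) (μ : DualBimodule k M) (β : M →ₗ[Bᵐᵒᵖ] Bᵐᵒᵖ)
    (h : ∀ m, t (unop (β m)) = μ m) : pairingOp ht μ = β :=
  ht.linearMap_op_ext fun m => by rw [form_pairingOp, h]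

theorem pairingOp_formCompOp (ht : IsSymmetrisingForm t) (β : M →ₗ[Bᵐᵒᵖ] Bᵐᵒᵖ) :
    pairingOp ht (formCompOp t β) = β :=
  pairingOp_eq ht _ _ fun _ => rfl

theorem pairingOp_add (ht : IsSymmetrisingForm t) (μ ν : DualBimodule k M) :
    pairingOp ht (μ + ν) = pairingOp ht μ + pairingOp ht ν :=
  pairingOp_eq ht _ _ fun m => by simp [form_pairingOp]

theorem pairingOp_op_smul (ht : IsSymmetrisingForm t) (a : A) (μ : DualBimodule k M) (m : M) :
    pairingOp ht (op a • μ) m = pairingOp ht μ (a • m) :=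
  congrArg (fun f : M →ₗ[Bᵐᵒᵖ] Bᵐᵒᵖ => f m)
    (pairingOp_eq ht (op a • μ)
      { toFun := fun m => pairingOp ht μ (a • m)
        map_add' := fun m n => by rw [smul_add, map_add]
        map_smul' := fun b m => by rw [smul_comm, map_smul]; rfl }
      fun m => form_pairingOp ht μ (a • m))

theorem pairingOp_smul (ht : IsSymmetrisingForm t) (b : B) (μ : DualBimodule k M) (m : M) :
    unop (pairingOp ht (b • μ) m) = b * unop (pairingOp ht μ m) :=
  congrArg (fun f : M →ₗ[Bᵐᵒᵖ] Bᵐᵒᵖ => unop (f m))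
    (pairingOp_eq ht (b • μ) ((pairingOp ht μ).smulRight (op b)) fun m => by
      rw [LinearMap.smulRight_apply, smul_eq_mul, MulOpposite.unop_mul, ht.mul_comm,
        DualBimodule.left_smul_apply, ← form_pairingOp ht μ, map_smul, smul_eq_mul,
        MulOpposite.unop_mul])

/-- The evaluation `M ⊗_B V → V`, `m ⊗ v ↦ ⟨μ, m⟩ v`, at an element `μ` of `M^∨`. As `μ` varies,
this is the counit `M^∨ ⊗_A M ⊗_B V → V` of the adjunction of `M^∨ ⊗_A -` and `M ⊗_B -`. -/
noncomputable def evalAtOp (ht : IsSymmetrisingForm t) (μ : DualBimodule k M) :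
    TensorOver k B M V →+ V :=
  TensorOver.lift
    { toFun := fun m =>
        { toFun := fun v => unop (pairingOp ht μ m) • v
          map_zero' := smul_zero _
          map_add' := fun x y => smul_add _ x y }
      map_zero' := by ext v; simp
      map_add' := fun m n => by ext v; simp [add_smul] }
    (fun c m v => by
      change unop (pairingOp ht μ (c • m)) • v = unop (pairingOp ht μ m) • c • v
      rw [LinearMap.map_smul_of_tower, MulOpposite.unop_smul, smul_assoc, smul_comm])
    (fun b m v => by
      change unop (pairingOp ht μ (op b • m)) • v = unop (pairingOp ht μ m) • b • v
      rw [map_smul, smul_eq_mul, MulOpposite.unop_mul, MulOpposite.unop_op, mul_smul])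

@[simp] theorem evalAtOp_tmul (ht : IsSymmetrisingForm t) (μ : DualBimodule k M) (m : M) (v : V) :
    evalAtOp ht μ (TensorOver.tmul k B m v) = unop (pairingOp ht μ m) • v := rfl

theorem evalAtOp_add (ht : IsSymmetrisingForm t) (μ ν : DualBimodule k M)
    (y : TensorOver k B M V) :
    evalAtOp ht (μ + ν) y = evalAtOp ht μ y + evalAtOp ht ν y := by
  induction y using TensorOver.induction_on with
  | zero => simp
  | tmul m v => simp [pairingOp_add, add_smul]
  | add x y hx hy => rw [map_add, hx, hy, map_add, map_add]; abel

theorem evalAtOp_smul (ht : IsSymmetrisingForm t) (b : B) (μ : DualBimodule k M)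
    (y : TensorOver k B M V) : evalAtOp ht (b • μ) y = b • evalAtOp ht μ y := by
  induction y using TensorOver.induction_on with
  | zero => simp
  | tmul m v => rw [evalAtOp_tmul, evalAtOp_tmul, pairingOp_smul, mul_smul]
  | add x y hx hy => rw [map_add, hx, hy, map_add, smul_add]

theorem evalAtOp_op_smul (ht : IsSymmetrisingForm t) (a : A) (μ : DualBimodule k M)
    (y : TensorOver k B M V) : evalAtOp ht (op a • μ) y = evalAtOp ht μ (a • y) := by
  induction y using TensorOver.induction_on with
  | zero => simp
  | tmul m v => rw [TensorOver.smul_tmul', evalAtOp_tmul, evalAtOp_tmul, pairingOp_op_smul]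
  | add x y hx hy => rw [map_add, hx, hy, smul_add, map_add]

section DualBasis

variable [Module.Finite Bᵐᵒᵖ M] [Module.Projective Bᵐᵒᵖ M]

/-- The elements `t ∘ β_j` and the maps `μ ↦ ⟨μ, n_j⟩` form a dual basis of `M^∨`. -/
theorem sum_pairingOp_smul_formCompOp (ht : IsSymmetrisingForm t) (μ : DualBimodule k M) :
    ∑ j, unop (pairingOp ht μ ((dualBasis Bᵐᵒᵖ M).vec j)) •
      formCompOp t ((dualBasis Bᵐᵒᵖ M).coord j) = μ := by
  ext m
  rw [DualBimodule.sum_apply, ← form_pairingOp ht μ m]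
  conv_rhs => rw [← (dualBasis Bᵐᵒᵖ M).sum_smul m, map_sum, Finset.unop_sum, map_sum]
  refine Finset.sum_congr rfl fun j _ => ?_
  rw [DualBimodule.left_smul_apply, formCompOp_apply, map_smul, map_smul, smul_eq_mul,
    smul_eq_mul, MulOpposite.unop_mul, MulOpposite.unop_mul, MulOpposite.unop_op, ht.mul_comm]

theorem sum_tmul_evalAtOp (ht : IsSymmetrisingForm t) (y : TensorOver k B M V) :
    ∑ j, TensorOver.tmul k B ((dualBasis Bᵐᵒᵖ M).vec j)
      (evalAtOp ht (formCompOp t ((dualBasis Bᵐᵒᵖ M).coord j)) y) = y := by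
  induction y using TensorOver.induction_on with
  | zero => simp [TensorOver.tmul_zero]
  | tmul m v =>
    simp only [evalAtOp_tmul, ← TensorOver.smul_tmul, pairingOp_formCompOp, MulOpposite.op_unop]
    rw [← TensorOver.sum_tmul, (dualBasis Bᵐᵒᵖ M).sum_smul]
  | add x y hx hy =>
    simp only [map_add, TensorOver.tmul_add, Finset.sum_add_distrib, hx, hy]

theorem adjunctionHom'_apply (ht : IsSymmetrisingForm t)
    (ψ : TensorOver k A (DualBimodule k M) X →ₗ[B] V) (x : X) :
    adjunctionHom' M X V ht ψ x = ∑ j, TensorOver.tmul k B ((dualBasis Bᵐᵒᵖ M).vec j)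
        (ψ (TensorOver.tmul k A (formCompOp t ((dualBasis Bᵐᵒᵖ M).coord j)) x)) := rfl

theorem evalAtOp_adjunctionHom' (ht : IsSymmetrisingForm t)
    (ψ : TensorOver k A (DualBimodule k M) X →ₗ[B] V) (μ : DualBimodule k M) (x : X) :
    evalAtOp ht μ (adjunctionHom' M X V ht ψ x) = ψ (TensorOver.tmul k A μ x) := by
  rw [adjunctionHom'_apply, map_sum]
  conv_rhs => rw [← sum_pairingOp_smul_formCompOp ht μ, TensorOver.sum_tmul, map_sum]
  refine Finset.sum_congr rfl fun j _ => ?_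
  rw [evalAtOp_tmul, ← TensorOver.smul_tmul', map_smul]

theorem adjunctionHom'_bijective (ht : IsSymmetrisingForm t) :
    Function.Bijective (adjunctionHom' (A := A) M X V ht) := by
  constructor
  · intro ψ ψ' h
    ext y
    induction y using TensorOver.induction_on with
    | zero => simp
    | tmul μ x => rw [← evalAtOp_adjunctionHom' ht, h, evalAtOp_adjunctionHom']
    | add x y hx hy => rw [map_add, map_add, hx, hy]
  · intro f
    let ψ : TensorOver k A (DualBimodule k M) X →+ V := TensorOver.lift
      { toFun := fun μ => (evalAtOp ht μ).comp (f : X →+ TensorOver k B M V)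
        map_zero' := by
          ext x
          have h := evalAtOp_smul ht 0 (0 : DualBimodule k M) (f x)
          simpa using h
        map_add' := fun μ ν => by ext x; simp [evalAtOp_add] }
      (fun c μ x => by
        change evalAtOp ht (c • μ) (f x) = evalAtOp ht μ (f (c • x))
        rw [← algebraMap_smul Aᵐᵒᵖ c μ, ← algebraMap_smul A c x, map_smul, ← evalAtOp_op_smul]
        rfl)
      (fun a μ x => by
        change evalAtOp ht (op a • μ) (f x) = evalAtOp ht μ (f (a • x))
        rw [map_smul, evalAtOp_op_smul])
    refine ⟨⟨⟨ψ, map_add ψ⟩, fun b y => ?_⟩, ?_⟩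
    · induction y using TensorOver.induction_on with
      | zero => simp
      | tmul μ x => exact evalAtOp_smul ht b μ (f x)
      | add x y hx hy => rw [smul_add]; simp_all
    · ext x
      exact sum_tmul_evalAtOp ht (f x)

theorem adjunctionHom'_comp_map (ht : IsSymmetrisingForm t)
    (ψ : TensorOver k A (DualBimodule k M) Y →ₗ[B] V) (g : X →ₗ[A] Y) :
    adjunctionHom' M X V ht (ψ ∘ₗ TensorOver.map (DualBimodule k M) B g) =
      adjunctionHom' M Y V ht ψ ∘ₗ g := by
  ext x
  simp [adjunctionHom'_apply]

end DualBasis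

/-! ### Bijectivity of the stable adjunctions -/

section StableAdjunction

variable [Module.Finite Bᵐᵒᵖ M] [Module.Projective Bᵐᵒᵖ M] [Module.Projective A M]

theorem stableAdjunction_bijective [Module.Finite A M] (hs : IsSymmetrisingForm s)
    (ht : IsSymmetrisingForm t) :
    Function.Bijective (stableAdjunction M X V hs ht :
      StableHom k A (TensorOver k B M V) X →ₗ[k]
        StableHom k B V (TensorOver k A (DualBimodule k M) X)) := by
  constructor
  · rw [injective_iff_map_eq_zero]
    intro y hy
    obtain ⟨φ, rfl⟩ := Submodule.Quotient.mk_surjective _ y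
    obtain ⟨P, _, _, g, h, hP, hφ⟩ := (Submodule.Quotient.mk_eq_zero _).1 hy
    letI : Module k P := Module.compHom P (algebraMap k B)
    haveI : IsScalarTower k B P := .of_algebraMap_smul fun _ _ => rfl
    obtain ⟨h', rfl⟩ := (adjunctionHom_bijective hs).2 h
    rw [← adjunctionHom_comp_map] at hφ
    rw [Submodule.Quotient.mk_eq_zero, (adjunctionHom_bijective hs).1 hφ]
    exact comp_mem_projHom k _ _
  · intro y
    obtain ⟨f, rfl⟩ := Submodule.Quotient.mk_surjective _ y
    obtain ⟨φ, rfl⟩ := (adjunctionHom_bijective hs).2 f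
    exact ⟨Submodule.Quotient.mk φ, rfl⟩

theorem stableAdjunction'_bijective (ht : IsSymmetrisingForm t) :
    Function.Bijective (stableAdjunction' M X V ht :
      StableHom k B (TensorOver k A (DualBimodule k M) X) V →ₗ[k]
        StableHom k A X (TensorOver k B M V)) := by
  constructor
  · rw [injective_iff_map_eq_zero]
    intro y hy
    obtain ⟨ψ, rfl⟩ := Submodule.Quotient.mk_surjective _ y
    obtain ⟨P, _, _, g, h, hP, hψ⟩ := (Submodule.Quotient.mk_eq_zero _).1 hy
    letI : Module k P := Module.compHom P (algebraMap k A)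
    haveI : IsScalarTower k A P := .of_algebraMap_smul fun _ _ => rfl
    haveI := DualBimodule.projective (k := k) (B := B) M ht
    obtain ⟨h', rfl⟩ := (adjunctionHom'_bijective ht).2 h
    rw [← adjunctionHom'_comp_map] at hψ
    rw [Submodule.Quotient.mk_eq_zero, (adjunctionHom'_bijective ht).1 hψ]
    exact comp_mem_projHom k _ _
  · intro y
    obtain ⟨f, rfl⟩ := Submodule.Quotient.mk_surjective _ y
    obtain ⟨ψ, rfl⟩ := (adjunctionHom'_bijective ht).2 f
    exact ⟨Submodule.Quotient.mk ψ, rfl⟩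

end StableAdjunction

end Evaluation

/-! ### Isomorphisms in the stable category -/

section StableHom

variable {k : Type*} [Field k] {R : Type*} [Ring R] [Algebra k R]
variable {X : Type*} [AddCommGroup X] [Module R X]
variable {Y : Type*} [AddCommGroup Y] [Module k Y] [Module R Y] [IsScalarTower k R Y]
variable {Z : Type*} [AddCommGroup Z] [Module k Z] [Module R Z] [IsScalarTower k R Z]

theorem comp_mem_projHom_left (g : Y →ₗ[R] Z) {f : X →ₗ[R] Y} (hf : f ∈ projHom k R X Y) :
    g ∘ₗ f ∈ projHom k R X Z := by
  obtain ⟨P, _, _, a, b, hP, rfl⟩ := hf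
  exact comp_mem_projHom k a (g ∘ₗ b)

theorem comp_mem_projHom_right {g : Y →ₗ[R] Z} (hg : g ∈ projHom k R Y Z) (f : X →ₗ[R] Y) :
    g ∘ₗ f ∈ projHom k R X Z := by
  obtain ⟨P, _, _, a, b, hP, rfl⟩ := hg
  exact comp_mem_projHom k (a ∘ₗ f) b

/-- Composition with `g` is bijective on stable morphisms if `g` has an inverse modulo maps that
factor through projectives. -/
theorem stablePostcomp_bijective (g : Y →ₗ[R] Z) (g' : Z →ₗ[R] Y)
    (h1 : g' ∘ₗ g - LinearMap.id ∈ projHom k R Y Y)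
    (h2 : g ∘ₗ g' - LinearMap.id ∈ projHom k R Z Z) :
    Function.Bijective (stablePostcomp k X g) := by
  constructor
  · rw [injective_iff_map_eq_zero]
    intro y hy
    obtain ⟨f, rfl⟩ := Submodule.Quotient.mk_surjective _ y
    have hf : g ∘ₗ f ∈ projHom k R X Z := (Submodule.Quotient.mk_eq_zero _).1 hy
    rw [Submodule.Quotient.mk_eq_zero]
    have : f = g' ∘ₗ (g ∘ₗ f) - (g' ∘ₗ g - LinearMap.id) ∘ₗ f := by ext x; simp
    rw [this]
    exact sub_mem (comp_mem_projHom_left g' hf) (comp_mem_projHom_right h1 f)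
  · intro y
    obtain ⟨f, rfl⟩ := Submodule.Quotient.mk_surjective _ y
    refine ⟨Submodule.Quotient.mk (g' ∘ₗ f), (Submodule.Quotient.eq _).2 ?_⟩
    have : g ∘ₗ (g' ∘ₗ f) - f = (g ∘ₗ g' - LinearMap.id) ∘ₗ f := by ext x; simp
    change g ∘ₗ (g' ∘ₗ f) - f ∈ projHom k R X Z
    rw [this]
    exact comp_mem_projHom_right h2 f

end StableHom

/-! ### Exactness of `M^∨ ⊗_A -` and the comparison of syzygies -/

section Omega

variable {k : Type*} [Field k] {A : Type*} [Ring A] [Algebra k A] {B : Type*} [Ring B]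
  [Algebra k B]
variable {s : Module.Dual k A} {t : Module.Dual k B}
variable {M : Type*} [AddCommGroup M] [Module k M] [Module A M] [Module Bᵐᵒᵖ M]
  [IsScalarTower k A M] [IsScalarTower k Bᵐᵒᵖ M] [SMulCommClass A Bᵐᵒᵖ M]
variable {U : Type*} [AddCommGroup U] [Module k U] [Module A U] [IsScalarTower k A U]
variable {V : Type*} [AddCommGroup V] [Module k V] [Module B V] [IsScalarTower k B V]
variable {P : Type*} [AddCommGroup P] [Module k P] [Module A P] [IsScalarTower k A P]
variable {Q : Type*} [AddCommGroup Q] [Module k Q] [Module B Q] [IsScalarTower k B Q]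

theorem TensorOver.map_surjective {π : P →ₗ[A] U} (hπ : Function.Surjective π) :
    Function.Surjective (TensorOver.map (k := k) (DualBimodule k M) B π) := by
  intro y
  induction y using TensorOver.induction_on with
  | zero => exact ⟨0, map_zero _⟩
  | tmul μ u =>
    obtain ⟨p, rfl⟩ := hπ u
    exact ⟨TensorOver.tmul k A μ p, rfl⟩
  | add x y hx hy =>
    obtain ⟨x, rfl⟩ := hx
    obtain ⟨y, rfl⟩ := hy
    exact ⟨x + y, map_add _ _ _⟩

section

variable [Module.Finite A M] [Module.Projective A M]

/-- Exactness of `M^∨ ⊗_A -` at the kernel: an element of `M^∨ ⊗_A P` is recovered from its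
evaluations in `P`, and these commute with `Id ⊗ π`. -/
theorem omegaComparison_id_bijective (hs : IsSymmetrisingForm s) (π : P →ₗ[A] U) :
    Function.Bijective (omegaComparison (k := k) (M := M) π
        (TensorOver.map (DualBimodule k M) B π) LinearMap.id (LinearMap.comp_id _)) := by
  constructor
  · rw [injective_iff_map_eq_zero]
    intro y hy
    have hy' : TensorOver.map (DualBimodule k M) B (LinearMap.ker π).subtype y = 0 :=
      congrArg Subtype.val hy
    have hev : ∀ m : M, evalAt hs m y = 0 := fun m => by
      apply Subtype.ext
      have h := evalAt_map (B := B) hs m (LinearMap.ker π).subtype y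
      rw [hy', map_zero] at h
      exact h.symm
    rw [← sum_formComp_tmul_evalAt hs y]
    simp [hev, TensorOver.tmul_zero]
  · rintro ⟨y, hy⟩
    rw [LinearMap.mem_ker] at hy
    have hev : ∀ m : M, evalAt hs m y ∈ LinearMap.ker π := fun m => by
      rw [LinearMap.mem_ker, ← evalAt_map (B := B), hy, map_zero]
    refine ⟨∑ i, TensorOver.tmul k A (formComp s ((dualBasis A M).coord i))
      ⟨evalAt hs ((dualBasis A M).vec i) y, hev _⟩, Subtype.ext ?_⟩
    change TensorOver.map (DualBimodule k M) B (LinearMap.ker π).subtype _ = y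
    rw [map_sum]
    exact sum_formComp_tmul_evalAt hs y

variable [Module.Finite Bᵐᵒᵖ M] [Module.Projective Bᵐᵒᵖ M]

/-- The comparison map is an isomorphism in the stable category. A lift `h' : Q → M^∨ ⊗_A P` of
`ρ` gives a stable inverse, because `h' ∘ h - 1` and `h ∘ h' - 1` map the projective modules
`M^∨ ⊗_A P` and `Q` into the respective kernels. -/
theorem stablePostcomp_omegaComparison_bijective (hs : IsSymmetrisingForm s)
    (ht : IsSymmetrisingForm t) [Module.Projective A P] [Module.Projective B Q]
    {π : P →ₗ[A] U} (hπ : Function.Surjective π)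
    (ρ : Q →ₗ[B] TensorOver k A (DualBimodule k M) U)
    (h : TensorOver k A (DualBimodule k M) P →ₗ[B] Q)
    (hh : ρ ∘ₗ h = TensorOver.map (DualBimodule k M) B π) :
    Function.Bijective
      (stablePostcomp k V (omegaComparison π ρ h hh) :
        StableHom k B V (TensorOver k A (DualBimodule k M) (LinearMap.ker π)) →ₗ[k]
          StableHom k B V (LinearMap.ker ρ)) := by
  haveI := DualBimodule.projective (k := k) (B := B) M ht
  let π' := TensorOver.map (k := k) (DualBimodule k M) B π
  obtain ⟨h', hh'⟩ := Module.projective_lifting_property π' ρ (TensorOver.map_surjective hπ)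
  have hhx : ∀ x, ρ (h x) = π' x := fun x => congrArg (fun l : _ →ₗ[B] _ => l x) hh
  have hhx' : ∀ x, π' (h' x) = ρ x := fun x => congrArg (fun l : _ →ₗ[B] _ => l x) hh'
  let e := LinearEquiv.ofBijective _ (omegaComparison_id_bijective (B := B) (M := M) hs π)
  have he : ∀ y, (e y : TensorOver k A (DualBimodule k M) P) =
    TensorOver.map (DualBimodule k M) B (LinearMap.ker π).subtype y := fun _ => rfl
  let r : LinearMap.ker ρ →ₗ[B] LinearMap.ker π' :=
    (h' ∘ₗ (LinearMap.ker ρ).subtype).codRestrict _ fun x => by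
      rw [LinearMap.mem_ker, LinearMap.comp_apply, hhx']
      exact x.2
  let d : TensorOver k A (DualBimodule k M) P →ₗ[B] LinearMap.ker π' :=
    (h' ∘ₗ h - LinearMap.id).codRestrict _ fun x => by
      rw [LinearMap.mem_ker, LinearMap.sub_apply, map_sub, LinearMap.comp_apply, hhx', hhx,
        LinearMap.id_apply, sub_self]
  let d' : Q →ₗ[B] LinearMap.ker ρ :=
    (h ∘ₗ h' - LinearMap.id).codRestrict _ fun x => by
      rw [LinearMap.mem_ker, LinearMap.sub_apply, map_sub, LinearMap.comp_apply, hhx, hhx',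
        LinearMap.id_apply, sub_self]
  refine stablePostcomp_bijective _ (e.symm.toLinearMap ∘ₗ r) ?_ ?_
  · have h1 : (e.symm.toLinearMap ∘ₗ r) ∘ₗ omegaComparison π ρ h hh - LinearMap.id =
        (e.symm.toLinearMap ∘ₗ d) ∘ₗ
          TensorOver.map (DualBimodule k M) B (LinearMap.ker π).subtype := by
      refine LinearMap.ext fun y => e.injective (Subtype.ext ?_)
      rw [LinearMap.sub_apply, map_sub]
      simp only [LinearMap.comp_apply, LinearEquiv.coe_coe, LinearEquiv.apply_symm_apply,
        LinearMap.id_apply]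
      rfl
    rw [h1]
    exact comp_mem_projHom k _ _
  · have h1 : omegaComparison π ρ h hh ∘ₗ (e.symm.toLinearMap ∘ₗ r) - LinearMap.id =
        d' ∘ₗ (LinearMap.ker ρ).subtype := by
      refine LinearMap.ext fun y => Subtype.ext ?_
      change h (TensorOver.map (DualBimodule k M) B (LinearMap.ker π).subtype (e.symm (r y))) - y =
        h (h' y) - y
      rw [← he, LinearEquiv.apply_symm_apply]
      rfl
    rw [h1]
    exact comp_mem_projHom k _ _

end

/-! ### Compatibility of the dualities with the adjunctions -/

section Compatibility

variable [Module.Finite Bᵐᵒᵖ M] [Module.Projective Bᵐᵒᵖ M]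

/-- The form `δ^` for a homomorphism `δ : V → M^∨`, in terms of a dual basis of `M` as right
`B`-module. -/
theorem homDual_dualBimodule (ht : IsSymmetrisingForm t) [Module.Finite B (DualBimodule k M)]
    [Module.Projective B (DualBimodule k M)] (δ : V →ₗ[B] DualBimodule k M)
    (f : DualBimodule k M →ₗ[B] V) :
    homDual t (DualBimodule k M) V δ f =
      ∑ j, δ (f (formCompOp t ((dualBasis Bᵐᵒᵖ M).coord j))) ((dualBasis Bᵐᵒᵖ M).vec j) := by
  let φ : Module.Dual k (DualBimodule k M →ₗ[B] V) :=
    { toFun := fun f =>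
        ∑ j, δ (f (formCompOp t ((dualBasis Bᵐᵒᵖ M).coord j))) ((dualBasis Bᵐᵒᵖ M).vec j)
      map_add' := fun f g => by simp [Finset.sum_add_distrib]
      map_smul' := fun c f => by simp [LinearMap.map_smul_of_tower, Finset.mul_sum] }
  have h := homDual_unique ht δ φ fun α v => by
    change ∑ j, δ (α (formCompOp t ((dualBasis Bᵐᵒᵖ M).coord j)) • v) ((dualBasis Bᵐᵒᵖ M).vec j) = _
    conv_rhs => rw [← sum_pairingOp_smul_formCompOp ht (δ v), map_sum, map_sum]
    refine Finset.sum_congr rfl fun j _ => ?_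
    rw [map_smul, map_smul, DualBimodule.left_smul_apply, ← form_pairingOp ht (δ v), map_smul,
      smul_eq_mul, smul_eq_mul, MulOpposite.unop_mul, MulOpposite.unop_op]
  exact (congrArg (fun φ : Module.Dual k (DualBimodule k M →ₗ[B] V) => φ f) h).symm

variable [Module.Finite A M] [Module.Projective A M]

/-- The forms `β^` are compatible with the two adjunctions: this is the commutativity of the
diagram before passage to the stable categories. -/
theorem homDual_adjunctionHom (hs : IsSymmetrisingForm s) (ht : IsSymmetrisingForm t)
    [Module.Finite A P] [Module.Projective A P] [Module.Finite B (DualBimodule k M)]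
    [Module.Projective B (DualBimodule k M)]
    [Module.Finite B (TensorOver k A (DualBimodule k M) P)]
    [Module.Projective B (TensorOver k A (DualBimodule k M) P)]
    (β : TensorOver k B M V →ₗ[A] P) (χ : TensorOver k A (DualBimodule k M) P →ₗ[B] V) :
    homDual t (TensorOver k A (DualBimodule k M) P) V (adjunctionHom M P V hs β) χ =
      homDual s P (TensorOver k B M V) β (adjunctionHom' M P V ht χ) := by
  -- Both sides are additive in `β`, so `β` may be taken of the form `y ↦ γ(y) p`.
  rw [eq_sum_smulRight β]
  simp only [map_sum, LinearMap.sum_apply]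
  refine Finset.sum_congr rfl fun i _ => ?_
  generalize (dualBasis A P).coord i ∘ₗ β = γ
  generalize (dualBasis A P).vec i = p
  rw [homDual_smulRight_left hs]
  let γv : V → M →ₗ[A] A := fun v =>
    { toFun := fun m => γ (TensorOver.tmul k B m v)
      map_add' := fun m n => by rw [TensorOver.add_tmul, map_add]
      map_smul' := fun a m => by rw [← TensorOver.smul_tmul', map_smul]; rfl }
  -- Then the adjoint of `β` is the composite of `δ : v ↦ s(γ(- ⊗ v))` and `μ ↦ μ ⊗ p`.
  let δ : V →ₗ[B] DualBimodule k M :=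
    { toFun := fun v => formComp s (γv v)
      map_add' := fun v w => by
        ext m
        change s (γ (TensorOver.tmul k B m (v + w))) =
          s (γ (TensorOver.tmul k B m v)) + s (γ (TensorOver.tmul k B m w))
        rw [TensorOver.tmul_add, map_add, map_add]
      map_smul' := fun b v => by
        ext m
        change s (γ (TensorOver.tmul k B m (b • v))) = s (γ (TensorOver.tmul k B (op b • m) v))
        rw [TensorOver.smul_tmul] }
  let θ : DualBimodule k M →ₗ[B] TensorOver k A (DualBimodule k M) P :=
    { toFun := fun μ => TensorOver.tmul k A μ p
      map_add' := fun μ ν => TensorOver.add_tmul k A μ ν p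
      map_smul' := fun b μ => (TensorOver.smul_tmul' b μ p).symm }
  have h1 : adjunctionHom M P V hs (γ.smulRight p) = θ ∘ₗ δ := by
    ext v
    exact adjunctionHom_smulRight hs γ p v (γv v) fun _ => rfl
  rw [h1, homDual_comp ht, homDual_dualBimodule ht, adjunctionHom'_apply, map_sum, map_sum]
  rfl

end Compatibility

end Omega

end TateDuality

theorem proposition4p3
    -- the symmetric algebras `A`, `B` with symmetrising forms `s`, `t`
    {k : Type*} [Field k]
    {A : Type*} [Ring A] [Algebra k A] [Module.Finite k A]
    {B : Type*} [Ring B] [Algebra k B] [Module.Finite k B]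
    {s : Module.Dual k A} (hs : IsSymmetrisingForm s)
    {t : Module.Dual k B} (ht : IsSymmetrisingForm t)
    -- the `A`-`B`-bimodule `M`
    (M : Type*) [AddCommGroup M] [Module k M] [Module A M] [Module Bᵐᵒᵖ M]
    [IsScalarTower k A M] [IsScalarTower k Bᵐᵒᵖ M] [SMulCommClass A Bᵐᵒᵖ M]
    [Module.Finite A M] [Module.Projective A M]
    [Module.Finite Bᵐᵒᵖ M] [Module.Projective Bᵐᵒᵖ M]
    -- the finitely generated modules `U` over `A` and `V` over `B`
    (U : Type*) [AddCommGroup U] [Module k U] [Module A U] [IsScalarTower k A U]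
    [Module.Finite A U]
    (V : Type*) [AddCommGroup V] [Module k V] [Module B V] [IsScalarTower k B V]
    [Module.Finite B V]
    -- the choice of `Ω(U) = ker π`
    {P : Type*} [AddCommGroup P] [Module k P] [Module A P] [IsScalarTower k A P]
    [Module.Finite A P] [Module.Projective A P]
    (π : P →ₗ[A] U) (hπ : Function.Surjective π)
    -- the choice of `Ω(M^∨ ⊗_A U) = ker ρ`
    {Q : Type*} [AddCommGroup Q] [Module k Q] [Module B Q] [IsScalarTower k B Q]
    [Module.Finite B Q] [Module.Projective B Q]
    (ρ : Q →ₗ[B] TensorOver k A (DualBimodule k M) U)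
    (hρ : Function.Surjective ρ)
    -- a lift of the identity of `M^∨ ⊗_A U`, which gives the identification of
    -- `M^∨ ⊗_A Ω(U)` with `Ω(M^∨ ⊗_A U)`
    (h : TensorOver k A (DualBimodule k M) P →ₗ[B] Q)
    (hh : ρ ∘ₗ h = TensorOver.map (DualBimodule k M) B π) :
    -- `M^∨ ⊗_A P` is finitely generated projective and `M^∨ ⊗_A ker π = ker (Id ⊗ π)`, so that
    -- `Q = M^∨ ⊗_A P`, `ρ = Id ⊗ π`, `h = Id` is one of the admissible choices
    (Module.Finite B (TensorOver k A (DualBimodule k M) P) ∧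
      Module.Projective B (TensorOver k A (DualBimodule k M) P) ∧
      Function.Surjective (TensorOver.map (k := k) (DualBimodule k M) B π) ∧
      Function.Bijective (omegaComparison (k := k) (M := M) π
        (TensorOver.map (DualBimodule k M) B π) LinearMap.id
        (LinearMap.comp_id _))) ∧
    -- all arrows of the diagram are isomorphisms
    Function.Bijective (stableAdjunction M (LinearMap.ker π) V hs ht :
      StableHom k A (TensorOver k B M V) (LinearMap.ker π) →ₗ[k]
        StableHom k B V (TensorOver k A (DualBimodule k M) (LinearMap.ker π))) ∧
    Function.Bijective
      (stablePostcomp k V (omegaComparison π ρ h hh) :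
        StableHom k B V (TensorOver k A (DualBimodule k M) (LinearMap.ker π)) →ₗ[k]
          StableHom k B V (LinearMap.ker ρ)) ∧
    Function.Bijective
      (tateDuality (TensorOver k B M V) hs π :
        StableHom k A (TensorOver k B M V) (LinearMap.ker π) →ₗ[k]
          Module.Dual k (StableHom k A U (TensorOver k B M V))) ∧
    Function.Bijective (tateDuality V ht ρ :
      StableHom k B V (LinearMap.ker ρ) →ₗ[k]
        Module.Dual k (StableHom k B (TensorOver k A (DualBimodule k M) U) V)) ∧
    Function.Bijective ((stableAdjunction' M U V ht :
      StableHom k B (TensorOver k A (DualBimodule k M) U) V →ₗ[k]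
        StableHom k A U (TensorOver k B M V)).dualMap) ∧
    -- the diagram commutes
    tateDuality V ht ρ ∘ₗ
        stablePostcomp k V (omegaComparison π ρ h hh) ∘ₗ
        (stableAdjunction M (LinearMap.ker π) V hs ht :
          StableHom k A (TensorOver k B M V) (LinearMap.ker π) →ₗ[k]
            StableHom k B V (TensorOver k A (DualBimodule k M) (LinearMap.ker π))) =
      (stableAdjunction' M U V ht : StableHom k B (TensorOver k A (DualBimodule k M) U) V →ₗ[k]
        StableHom k A U (TensorOver k B M V)).dualMap ∘ₗ
        tateDuality (TensorOver k B M V) hs π := by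
  haveI := DualBimodule.projective (k := k) (B := B) M ht
  haveI : Module.Finite k M := Module.Finite.trans A M
  haveI : Module.Finite k (DualBimodule k M) := inferInstanceAs (Module.Finite k (Module.Dual k M))
  haveI : Module.Finite B (DualBimodule k M) := Module.Finite.of_restrictScalars_finite k B _
  refine ⟨⟨inferInstance, inferInstance, TensorOver.map_surjective hπ,
    omegaComparison_id_bijective hs π⟩, stableAdjunction_bijective hs ht,
    stablePostcomp_omegaComparison_bijective hs ht hπ ρ h hh,
    ⟨tateDuality_injective hs hπ, tateDuality_surjective hs hπ⟩,
    ⟨tateDuality_injective ht hρ, tateDuality_surjective ht hρ⟩,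
    (LinearEquiv.ofBijective _ (stableAdjunction'_bijective ht)).dualMap.bijective, ?_⟩
  ext φ ψ
  change homDual t Q V ((LinearMap.ker ρ).subtype ∘ₗ omegaComparison π ρ h hh ∘ₗ
      adjunctionHom M (LinearMap.ker π) V hs φ) (ψ ∘ₗ ρ) =
    homDual s P (TensorOver k B M V) ((LinearMap.ker π).subtype ∘ₗ φ)
      (adjunctionHom' M U V ht ψ ∘ₗ π)
  have h1 : (LinearMap.ker ρ).subtype ∘ₗ omegaComparison π ρ h hh ∘ₗ
      adjunctionHom M (LinearMap.ker π) V hs φ =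
      h ∘ₗ adjunctionHom M P V hs ((LinearMap.ker π).subtype ∘ₗ φ) := by
    rw [adjunctionHom_comp]
    rfl
  rw [h1, homDual_comp ht, LinearMap.comp_assoc, hh, homDual_adjunctionHom hs ht,
    adjunctionHom'_comp_map]
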